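/- Let $p$ be a prime and $R=M_3(\mathrm{GF}(p))$. The commuting graph $\Gamma(R)$ is the simple graph whose vertices are the non-central elements of $R$, two different elements being joined iff they commute. For $A\in R$ let $\langle A\rangle_1=\{q(A): q\in\mathbb Z[x]\}$. The unital compressed commuting graph $\Lambda^1(R)$ is the undirected graph (with loops allowed) whose vertices are the subrings $\langle A\rangle_1$, $A\in R$, where $\langle A\rangle_1$ and $\langle B\rangle_1$ are joined iff $AB=BA$ (so every vertex has a loop). According to its characteristic polynomial $p_A$ and minimal polynomial $m_A$, a matrix $A\in R$ is of type (A) if $p_A=(x-\lambda)^3$, $m_A=x-\lambda$; (B) if $p_A=(x-\lambda)(x-\mu)^2$, $m_A=(x-\lambda)(x-\mu)$; (C) if $p_A=m_A=(x-\lambda)(x-\mu)(x-\nu)$; (D) if $p_A=m_A=(x-\lambda)^3$; (E) if $p_A=(x-\lambda)^3$, $m_A=(x-\lambda)^2$; (F) if $p_A=m_A=(x-\lambda)^2(x-\mu)$; (G) if $p_A=m_A$ is irreducible; (H) if $p_A=m_A=(x-\lambda)p_1$ with $p_1$ irreducible over $\mathrm{GF}(p)$; here $\lambda,\mu,\nu\in\mathrm{GF}(p)$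 are distinct. Put $\mathrm{gen}_{(A)}=p$, $\mathrm{gen}_{(B)}=\mathrm{gen}_{(E)}=p(p-1)$, $\mathrm{gen}_{(C)}=p(p-1)(p-2)$, $\mathrm{gen}_{(D)}=\mathrm{gen}_{(H)}=p^2(p-1)$, $\mathrm{gen}_{(F)}=p(p-1)^2$, $\mathrm{gen}_{(G)}=p^3-p$. Then every $A\in R$ has exactly one type, all generators of a vertex of $\Lambda^1(R)$ have the same type (the type of the vertex), the vertex consisting of the scalar matrices is the only vertex of type (A), and a vertex of type (X) has exactly $\mathrm{gen}_{(X)}$ single generators. Moreover: (1) $\Gamma(R)$ is obtained from $\Lambda^1(R)$ by deleting the scalar vertex with all its edges, then deleting all loops, and then blowing up each remaining vertex $v$, of type (X), into a clique of size $\mathrm{gen}_{(X)}$, each vertex of which is joined to everything $v$ was joined to, so that vertices of two different cliques are joined iff the original vertices were. More precisely, there is an isomorphism from $\Gamma(R)$ onto the blown-up graph that maps each matrix $A$ into the clique that replaces $\langle A\rangle_1$. (2) After the scalar vertex and the loops are deleted from $\Lambda^1(R)$, and before the blow-up, the connected components are $\tfrac13(p^3-p)(p^3-p^2)$ single vertices,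 which are precisely the vertices of type (G), and one further component, which consists of all vertices of types (B), (C), (D), (E), (F) and (H). (3) The connected components of $\Gamma(R)$ are $\tfrac13(p^3-p)(p^3-p^2)$ cliques of size $p^3-p$, consisting of matrices of type (G), and one further component, whose vertices are precisely the matrices of types (B), (C), (D), (E), (F) and (H). -/

import Mathlib

open Polynomial

/-- An undirected graph on `V` without multiple edges, in which loops are allowed. -/
@[ext] structure LoopGraph (V : Type*) where
  Adj : V → V → Prop
  symm : ∀ v w, Adj v w → Adj w v

namespace LoopGraph

variable {V : Type*}

/-- Remove the vertex `v` together with all edges incident to it. -/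
def deleteVertex (G : LoopGraph V) (v : V) : LoopGraph {w : V // w ≠ v} where
  Adj x y := G.Adj x.1 y.1
  symm x y h := G.symm x.1 y.1 h

/-- Remove all loops. -/
def removeLoops (G : LoopGraph V) : SimpleGraph V where
  Adj x y := x ≠ y ∧ G.Adj x y
  symm := ⟨fun x y h => ⟨h.1.symm, G.symm x y h.2⟩⟩
  loopless := ⟨fun _ h => h.1 rfl⟩

end LoopGraph

/-- Blow up every vertex `v` of `G` into a clique with `n v` vertices, each vertex of the clique
being joined to everything that `v` was joined to (that is, to all vertices of the cliques that
replace the neighbors of `v`). -/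
def SimpleGraph.cliqueBlowUp {V : Type*} (G : SimpleGraph V) (n : V → ℕ) :
    SimpleGraph (Σ v : V, Fin (n v)) where
  Adj x y := (x.1 = y.1 ∧ x ≠ y) ∨ G.Adj x.1 y.1
  symm := ⟨fun _ _ h => h.elim (fun h => Or.inl ⟨h.1.symm, h.2.symm⟩) (fun h => Or.inr h.symm)⟩
  loopless := ⟨fun _ h => h.elim (fun h => h.2 rfl) (fun h => G.irrefl h)⟩

section Rings

variable {R : Type*} [Ring R]

/-- The unital subring `{q(a) : q ∈ ℤ[x]}` generated by `a`. -/
noncomputable def singleGen (a : R) : Subring R := (aeval a : ℤ[X] →ₐ[ℤ] R).toRingHom.range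

theorem mem_singleGen {a b : R} : b ∈ singleGen a ↔ ∃ q : ℤ[X], aeval a q = b := Iff.rfl

theorem self_mem_singleGen (a : R) : a ∈ singleGen a := ⟨X, by simp⟩

theorem commute_of_mem_singleGen {a b c : R} (h : Commute a c) (hb : b ∈ singleGen a) :
    Commute b c := by
  obtain ⟨q, rfl⟩ := mem_singleGen.1 hb
  induction q using Polynomial.induction_on' with
  | add f g hf hg => simpa using (hf ⟨f, rfl⟩).add_left (hg ⟨g, rfl⟩)
  | monomial n m =>
    rw [aeval_monomial]
    exact Commute.mul_left (Algebra.commutes m c) (h.pow_left n)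

variable (R) in
/-- The vertices of the unital compressed commuting graph: the unital subrings of `R` generated
by one element. -/
abbrev CompressedVertex : Type _ := {S : Subring R // ∃ a : R, singleGen a = S}

/-- The vertex generated by `a`. -/
noncomputable def vertexOf (a : R) : CompressedVertex R := ⟨singleGen a, a, rfl⟩

variable (R) in
/-- The unital compressed commuting graph `Λ¹(R)`: the vertices generated by `a` and by `b` are
joined if and only if `a * b = b * a`. -/
def unitalCompressedCommutingGraph : LoopGraph (CompressedVertex R) where
  Adj v w := ∃ a b : R, vertexOf a = v ∧ vertexOf b = w ∧ a * b = b * a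
  symm := fun _ _ ⟨a, b, ha, hb, h⟩ => ⟨b, a, hb, ha, h.symm⟩

/-- Adjacency in `Λ¹(R)` does not depend on the chosen generators. -/
theorem unitalCompressedCommutingGraph_adj (a b : R) :
    (unitalCompressedCommutingGraph R).Adj (vertexOf a) (vertexOf b) ↔ a * b = b * a := by
  constructor
  · rintro ⟨a', b', ha, hb, h⟩
    have ha' : a ∈ singleGen a' := by
      rw [show singleGen a' = singleGen a from congrArg Subtype.val ha]
      exact self_mem_singleGen a
    have hb' : b ∈ singleGen b' := by
      rw [show singleGen b' = singleGen b from congrArg Subtype.val hb]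
      exact self_mem_singleGen b
    exact (commute_of_mem_singleGen (commute_of_mem_singleGen h ha').symm hb').symm
  · exact fun h => ⟨a, b, rfl, rfl, h⟩

variable (R) in
/-- The commuting graph `Γ(R)`: its vertices are the noncentral elements of `R`, and two different
vertices are joined if and only if they commute. -/
def commutingGraph : SimpleGraph {a : R // a ∉ Subring.center R} where
  Adj a b := a ≠ b ∧ a.1 * b.1 = b.1 * a.1
  symm := ⟨fun _ _ h => ⟨h.1.symm, h.2.symm⟩⟩
  loopless := ⟨fun _ h => h.1 rfl⟩

end Rings

/-- The names of the eight types of `3 × 3` matrices over `GF(p)`. -/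
inductive MatrixKind
  | A | B | C | D | E | F | G | H

/-- `IsOfKind M X` says that the matrix `M` is of type (X). -/
def IsOfKind {p : ℕ} [Fact p.Prime] (M : Matrix (Fin 3) (Fin 3) (ZMod p)) : MatrixKind → Prop
  | .A => ∃ l : ZMod p,
      M.charpoly = (X - C l) ^ 3 ∧ minpoly (ZMod p) M = X - C l
  | .B => ∃ l m : ZMod p, l ≠ m ∧
      M.charpoly = (X - C l) * (X - C m) ^ 2 ∧ minpoly (ZMod p) M = (X - C l) * (X - C m)
  | .C => ∃ l m n : ZMod p, l ≠ m ∧ l ≠ n ∧ m ≠ n ∧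
      M.charpoly = (X - C l) * (X - C m) * (X - C n) ∧ minpoly (ZMod p) M = M.charpoly
  | .D => ∃ l : ZMod p,
      M.charpoly = (X - C l) ^ 3 ∧ minpoly (ZMod p) M = M.charpoly
  | .E => ∃ l : ZMod p,
      M.charpoly = (X - C l) ^ 3 ∧ minpoly (ZMod p) M = (X - C l) ^ 2
  | .F => ∃ l m : ZMod p, l ≠ m ∧
      M.charpoly = (X - C l) ^ 2 * (X - C m) ∧ minpoly (ZMod p) M = M.charpoly
  | .G => Irreducible M.charpoly ∧ minpoly (ZMod p) M = M.charpoly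
  | .H => ∃ (l : ZMod p) (f : (ZMod p)[X]), Irreducible f ∧
      M.charpoly = (X - C l) * f ∧ minpoly (ZMod p) M = M.charpoly

/-- The number `gen_(X)` of single generators of a vertex of type (X). -/
def genNumber (p : ℕ) : MatrixKind → ℕ
  | .A => p
  | .B => p * (p - 1)
  | .C => p * (p - 1) * (p - 2)
  | .D => p ^ 2 * (p - 1)
  | .E => p * (p - 1)
  | .F => p * (p - 1) ^ 2
  | .G => p ^ 3 - p
  | .H => p ^ 2 * (p - 1)

/-- The vertex of `Λ¹(M₃(GF(p)))` generated by the identity matrix (equivalently, by any scalar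
matrix). -/
noncomputable def scalarVertex (p : ℕ) : CompressedVertex (Matrix (Fin 3) (Fin 3) (ZMod p)) := vertexOf 1

/-- `Λ¹(M₃(GF(p)))` with the scalar vertex (and its edges) and then all loops removed. -/
noncomputable def reducedCompressedGraph (p : ℕ) :
    SimpleGraph {v : CompressedVertex (Matrix (Fin 3) (Fin 3) (ZMod p)) // v ≠ scalarVertex p} :=
  ((unitalCompressedCommutingGraph (Matrix (Fin 3) (Fin 3) (ZMod p))).deleteVertex
    (scalarVertex p)).removeLoops

/-!
Over `GF(p)` the ring generated by `a` is the algebra `GF(p)[a] ≅ GF(p)[x]/(m_a)`. The type of a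
`3 × 3` matrix is determined by three invariants of its minimal polynomial
(`MatrixKind.invariants`): the degree, the number of roots in `GF(p)`, and squarefreeness.

The generators of a vertex are counted uniformly. If `m_a` has degree three, then
`b = x + y a + z a²` generates the same ring as `a` if and only if the determinant of `1, b, b²` with
respect to `1, a, a²` is nonzero. This determinant (`indexForm`) is a binary cubic form in `(y, z)`
that is, after a shift of `y`, the homogenized characteristic polynomial of `a`; hence its zeros on
the projective line are in bijection with the `r` roots of `m_a`, and there are
`p (p - 1) (p + 1 - r)` generators (`natCard_generators_of_natDegree_eq_three`). For all types of
degree three this is `genNumber`. It also shows that `r` depends only on the vertex. Together with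
`|GF(p)[a]| = p ^ deg m_a` and the fact that `GF(p)[a]` is reduced if and only if `m_a` is squarefree,
this makes the type an invariant of the vertex (`IsOfKind.of_vertexOf_eq`).

A matrix that is not of type (G) has an eigenvalue, hence a right eigenvector `u` and a left
eigenvector `v` for it, and commutes with `u vᵀ`. In dimension three any two such rank-one matrices
commute with a common third one (`commutingGraph_reachable_of_not_G`), so everything outside type (G)
is in one component. A matrix `M` of type (G) has a cyclic vector, so its centralizer is the field
`GF(p)[M]`. The index form has no zeros, so every nonscalar element of this field generates it
(`vertexOf_eq_of_commute`), and the component of `M` consists of the generators of one vertex.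

To count the vertices of type (G), an irreducible cubic `f` is fixed. The pairs of a nonzero vector `v`
and a matrix `M` with characteristic polynomial `f` correspond to the bases `v, M v, M² v`, so there
are `(p³ - p)(p³ - p²)` such matrices (`natCard_charpoly_eq`). Each field `GF(p)[M]` with `M` of type
(G) contains exactly three of them, since `f` has three roots in a field with `p³` elements
(`natCard_charpoly_eq_and_vertexOf_eq`).
-/

/-! ### Subrings generated by one element -/

theorem singleGen_le_iff {R : Type*} [Ring R] {a b : R} :
    singleGen a ≤ singleGen b ↔ a ∈ singleGen b := by
  refine ⟨fun h => h (self_mem_singleGen a), ?_⟩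
  rintro ha _ ⟨q, rfl⟩
  obtain ⟨r, rfl⟩ := mem_singleGen.1 ha
  exact ⟨q.comp r, aeval_comp _⟩

theorem vertexOf_eq_iff {R : Type*} [Ring R] {a b : R} :
    vertexOf a = vertexOf b ↔ a ∈ singleGen b ∧ b ∈ singleGen a := by
  rw [← singleGen_le_iff, ← singleGen_le_iff, ← le_antisymm_iff]
  exact Subtype.ext_iff

theorem vertexOf_surjective {R : Type*} [Ring R] : Function.Surjective (vertexOf : R → _) := by
  rintro ⟨S, a, rfl⟩
  exact ⟨a, rfl⟩

section CharP

variable {p : ℕ} [Fact p.Prime] {R : Type*} [Ring R] [Algebra (ZMod p) R]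

/-- Since `ℤ → GF(p)` is onto, the subring generated by `a` is the `GF(p)`-algebra generated
by `a`. -/
theorem mem_singleGen_iff_aeval {a b : R} :
    b ∈ singleGen a ↔ ∃ q : (ZMod p)[X], aeval a q = b := by
  rw [mem_singleGen]
  have key (q : ℤ[X]) : aeval a (q.map (algebraMap ℤ (ZMod p))) = aeval a q :=
    aeval_map_algebraMap _ _ _
  constructor
  · rintro ⟨q, rfl⟩
    exact ⟨_, key q⟩
  · rintro ⟨q, rfl⟩
    obtain ⟨q, rfl⟩ := Polynomial.map_surjective (algebraMap ℤ (ZMod p))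
      ZMod.intCast_surjective q
    exact ⟨q, (key q).symm⟩

theorem aeval_mem_singleGen (a : R) (q : (ZMod p)[X]) : aeval a q ∈ singleGen a :=
  mem_singleGen_iff_aeval.2 ⟨q, rfl⟩

theorem eq_zero_of_aeval_eq_zero_of_degree_lt {a : R} {q : (ZMod p)[X]}
    (hq : q.degree < (minpoly (ZMod p) a).degree) (h : aeval a q = 0) : q = 0 :=
  eq_zero_of_dvd_of_degree_lt (minpoly.dvd _ _ h) hq

variable [Finite R]

theorem isIntegral_of_finite_zmod (a : R) : IsIntegral (ZMod p) a := 
  Algebra.IsIntegral.isIntegral a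

theorem minpoly_ne_zero_zmod (a : R) : minpoly (ZMod p) a ≠ 0 :=
  minpoly.ne_zero (isIntegral_of_finite_zmod a)

/-- The powers `a ^ i`, `i < deg m_a`, are a basis of the subring generated by `a`. -/
theorem natCard_singleGen (a : R) :
    Nat.card (singleGen a) = p ^ (minpoly (ZMod p) a).natDegree := by
  set m := minpoly (ZMod p) a with hm
  have hm1 : m.Monic := minpoly.monic (isIntegral_of_finite_zmod a)
  let f : degreeLT (ZMod p) m.natDegree → singleGen a :=
    fun q => ⟨aeval a q.1, aeval_mem_singleGen a q.1⟩
  have hf : Function.Bijective f := by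
    constructor
    · intro q r h
      have h' : aeval a (q.1 - r.1) = 0 := by
        rw [map_sub, sub_eq_zero]; exact congrArg Subtype.val h
      have hd : (q.1 - r.1).degree < m.degree := by
        rw [degree_eq_natDegree hm1.ne_zero]
        exact mem_degreeLT.1 (Submodule.sub_mem _ q.2 r.2)
      exact Subtype.ext (sub_eq_zero.1 (eq_zero_of_aeval_eq_zero_of_degree_lt hd h'))
    · rintro ⟨b, hb⟩
      obtain ⟨q, rfl⟩ := (mem_singleGen_iff_aeval (p := p)).1 hb
      refine ⟨⟨q %ₘ m, ?_⟩, ?_⟩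
      · rw [mem_degreeLT, ← degree_eq_natDegree hm1.ne_zero]
        exact degree_modByMonic_lt q hm1
      · apply Subtype.ext
        change aeval a (q %ₘ m) = aeval a q
        exact aeval_modByMonic_eq_self_of_root (minpoly.aeval _ _)
  rw [← Nat.card_congr (Equiv.ofBijective f hf),
    Nat.card_congr (degreeLTEquiv (ZMod p) m.natDegree).toEquiv]
  simp

theorem natDegree_minpoly_eq_of_vertexOf_eq {a b : R} (h : vertexOf a = vertexOf b) :
    (minpoly (ZMod p) a).natDegree = (minpoly (ZMod p) b).natDegree := by
  have h1 := natCard_singleGen (p := p) a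
  rw [show singleGen a = singleGen b from congrArg Subtype.val h, natCard_singleGen (p := p)] at h1
  exact (Nat.pow_right_injective (Fact.out : p.Prime).two_le h1).symm

/-- The ring generated by `a` is `GF(p)[x]/(m_a)`, which is reduced if and only if `m_a` is
squarefree. -/
theorem isReduced_singleGen_iff (a : R) :
    IsReduced (singleGen a) ↔ Squarefree (minpoly (ZMod p) a) := by
  rw [← isRadical_iff_squarefree_of_ne_zero (minpoly_ne_zero_zmod a)]
  constructor
  · intro h n q hq
    have h0 : (⟨aeval a q, aeval_mem_singleGen a q⟩ : singleGen a) ^ n = 0 := by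
      apply Subtype.ext
      change aeval a q ^ n = 0
      rw [← map_pow]
      exact (minpoly.dvd_iff).1 hq
    exact minpoly.dvd _ _ (congrArg Subtype.val (eq_zero_of_pow_eq_zero h0))
  · refine fun h => ⟨?_⟩
    rintro ⟨x, hx⟩ ⟨n, hn⟩
    obtain ⟨q, rfl⟩ := (mem_singleGen_iff_aeval (p := p)).1 hx
    have hn' : aeval a (q ^ n) = 0 := by rw [map_pow]; exact congrArg Subtype.val hn
    exact Subtype.ext ((minpoly.dvd_iff).1 (h n q (minpoly.dvd _ _ hn')))

theorem squarefree_minpoly_iff_of_vertexOf_eq {a b : R} (h : vertexOf a = vertexOf b) :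
    Squarefree (minpoly (ZMod p) a) ↔ Squarefree (minpoly (ZMod p) b) := by
  rw [← isReduced_singleGen_iff, ← isReduced_singleGen_iff,
    show singleGen a = singleGen b from congrArg Subtype.val h]

end CharP

/-! ### Counting single generators -/

section Generators

variable {p : ℕ} [Fact p.Prime] {R : Type*} [Ring R] [Algebra (ZMod p) R]

theorem exists_eq_cubic {K : Type*} [Field K] {f : K[X]} (hf : f.Monic) (hd : f.natDegree = 3) :
    ∃ s t u : K, f = X ^ 3 - C s * X ^ 2 - C t * X - C u := by
  refine ⟨-f.coeff 2, -f.coeff 1, -f.coeff 0, ?_⟩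
  conv_lhs => rw [hf.as_sum, hd]
  simp [Finset.sum_range_succ]
  ring

theorem quadratic_eq_zero {K : Type*} [Field K] {x y z : K}
    (h : C x + C y * X + C z * X ^ 2 = 0) : x = 0 ∧ y = 0 ∧ z = 0 := by
  refine ⟨?_, ?_, ?_⟩
  · simpa [coeff_X, coeff_C, coeff_X_pow, -map_eq_zero] using congrArg (coeff · 0) h
  · simpa [coeff_X, coeff_C, coeff_X_pow] using congrArg (coeff · 1) h
  · simpa [coeff_X, coeff_C, coeff_X_pow] using congrArg (coeff · 2) h

theorem exists_aeval_quadratic_of_mem {a b : R}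
    (hd : (minpoly (ZMod p) a).natDegree = 3) (hb : b ∈ singleGen a) :
    ∃ x y z : ZMod p, b = aeval a (C x + C y * X + C z * X ^ 2) := by
  obtain ⟨q, rfl⟩ := (mem_singleGen_iff_aeval (p := p)).1 hb
  have hm : (minpoly (ZMod p) a).Monic := by
    refine minpoly.monic (by_contra fun h => ?_)
    rw [minpoly.eq_zero h] at hd
    simp at hd
  have hlt : (q %ₘ minpoly (ZMod p) a).natDegree < 3 := by
    rw [← hd]
    exact natDegree_modByMonic_lt _ hm (fun h => by rw [h] at hd; simp at hd)
  rw [← aeval_modByMonic_eq_self_of_root (minpoly.aeval _ a)]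
  set r := q %ₘ minpoly (ZMod p) a
  refine ⟨r.coeff 0, r.coeff 1, r.coeff 2, congrArg (aeval a) ?_⟩
  rw [as_sum_range_C_mul_X_pow' r hlt]
  simp [Finset.sum_range_succ]

theorem aeval_quadratic_injective {a : R} (hd : (minpoly (ZMod p) a).natDegree = 3)
    {x y z x' y' z' : ZMod p}
    (h : aeval a (C x + C y * X + C z * X ^ 2) = aeval a (C x' + C y' * X + C z' * X ^ 2)) :
    x = x' ∧ y = y' ∧ z = z' := by
  have h0 : C (x - x') + C (y - y') * X + C (z - z') * X ^ 2 = 0 := by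
    refine eq_zero_of_aeval_eq_zero_of_degree_lt (a := a) ?_ ?_
    · rw [degree_eq_natDegree (p := minpoly (ZMod p) a) (fun h => by simp [h] at hd), hd]
      have : (C (x - x') + C (y - y') * X + C (z - z') * X ^ 2).degree ≤ 2 := by compute_degree
      exact this.trans_lt (by norm_num)
    · rw [← sub_eq_zero, ← map_sub] at h
      rw [← h]
      congr 1
      simp only [C_sub]
      ring
  obtain ⟨h1, h2, h3⟩ := quadratic_eq_zero h0
  exact ⟨sub_eq_zero.1 h1, sub_eq_zero.1 h2, sub_eq_zero.1 h3⟩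

/-- The determinant of `1, b, b²` with respect to `1, a, a²`, where `a³ = s a² + t a + u` and
`b = x + y a + z a²`. It is the characteristic polynomial of `a`, made homogeneous, at
`(y + s z, z)`. -/
def indexForm {K : Type*} [Field K] (s t u y z : K) : K :=
  (y + s * z) ^ 3 - s * (y + s * z) ^ 2 * z - t * (y + s * z) * z ^ 2 - u * z ^ 3

theorem algebraMap_mem_singleGen (c : ZMod p) (b : R) : algebraMap (ZMod p) R c ∈ singleGen b :=
  mem_singleGen_iff_aeval.2 ⟨C c, aeval_C _ _⟩

theorem mem_singleGen_algebraMap_iff {c : ZMod p} {b : R} :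
    b ∈ singleGen (algebraMap (ZMod p) R c) ↔ ∃ d : ZMod p, b = algebraMap (ZMod p) R d := by
  refine ⟨fun h => ?_, ?_⟩
  · obtain ⟨q, rfl⟩ := (mem_singleGen_iff_aeval (p := p)).1 h
    exact ⟨q.eval c, aeval_algebraMap_apply_eq_algebraMap_eval c q⟩
  · rintro ⟨d, rfl⟩
    exact algebraMap_mem_singleGen d _

theorem vertexOf_eq_vertexOf_one_iff {b : R} :
    vertexOf b = vertexOf 1 ↔ ∃ d : ZMod p, b = algebraMap (ZMod p) R d := by
  rw [vertexOf_eq_iff, ← (algebraMap (ZMod p) R).map_one, mem_singleGen_algebraMap_iff]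
  exact and_iff_left (algebraMap_mem_singleGen 1 b)

variable [Finite R]

/-- If the index form vanishes, then `1, b, b²` are linearly dependent and the ring generated by `b`
is too small to contain `a`; otherwise Cramer's rule expresses `a` by `1, b, b²`. -/
theorem mem_singleGen_quadratic_iff {a : R} {s t u : ZMod p}
    (hm : minpoly (ZMod p) a = X ^ 3 - C s * X ^ 2 - C t * X - C u) (x y z : ZMod p) :
    a ∈ singleGen (aeval a (C x + C y * X + C z * X ^ 2)) ↔ indexForm s t u y z ≠ 0 := by
  have hd : (minpoly (ZMod p) a).natDegree = 3 := by rw [hm]; compute_degree!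
  set b := aeval a (C x + C y * X + C z * X ^ 2) with hb
  -- `(b - x)² = e₀ + e₁ a + e₂ a²`
  obtain ⟨e₂, he₂⟩ : ∃ e, e = y ^ 2 + 2 * y * z * s + z ^ 2 * (s ^ 2 + t) := ⟨_, rfl⟩
  obtain ⟨e₀, he₀⟩ : ∃ e, e = 2 * y * z * u + z ^ 2 * s * u := ⟨_, rfl⟩
  set Q : (ZMod p)[X] := C e₂ * (X - C x) - C z * (X - C x) ^ 2 + C (z * e₀) with hQ
  have key : aeval b Q = aeval a (C (indexForm s t u y z) * X) := by
    rw [hb, ← aeval_comp, ← sub_eq_zero, ← map_sub]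
    refine (minpoly.dvd_iff).1 ⟨-(C z * (C (z ^ 2) * X + C (2 * y * z + z ^ 2 * s))), ?_⟩
    rw [hm, hQ, he₂, he₀, indexForm]
    simp only [add_comp, sub_comp, mul_comp, pow_comp, C_comp, X_comp, ofNat_comp, map_add, map_sub,
      map_mul, map_pow, map_ofNat]
    ring
  constructor
  · intro ha h0
    have hbd : (minpoly (ZMod p) b).natDegree = 3 := by
      rw [← hd]
      exact natDegree_minpoly_eq_of_vertexOf_eq (vertexOf_eq_iff.2 ⟨aeval_mem_singleGen _ _, ha⟩)
    have hbd' : (minpoly (ZMod p) b).degree = 3 := by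
      rw [degree_eq_natDegree (minpoly_ne_zero_zmod b), hbd]; rfl
    have hQ0 : Q = 0 := by
      refine eq_zero_of_aeval_eq_zero_of_degree_lt (a := b) ?_ (by rw [key, h0]; simp)
      rw [hbd']
      have : Q.degree ≤ 2 := by rw [hQ]; compute_degree
      exact this.trans_lt (by norm_num)
    obtain ⟨-, hy, hz⟩ := quadratic_eq_zero (x := z * e₀ - e₂ * x - z * x ^ 2)
      (y := e₂ + 2 * z * x) (z := -z) (by
        rw [← hQ0, hQ]
        simp only [map_add, map_sub, map_mul, map_pow, map_neg, map_ofNat]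
        ring)
    rw [neg_eq_zero] at hz
    have hy : y = 0 := by simpa [he₂, hz] using hy
    have hX : (X - C x : (ZMod p)[X]) = 0 := by
      refine eq_zero_of_aeval_eq_zero_of_degree_lt (a := b) ?_ ?_
      · rw [hbd', degree_X_sub_C]; norm_num
      · simp [hb, hy, hz]
    exact X_sub_C_ne_zero x hX
  · intro h0
    refine (mem_singleGen_iff_aeval (p := p)).2 ⟨C (indexForm s t u y z)⁻¹ * Q, ?_⟩
    rw [map_mul, key, map_mul, aeval_C, aeval_C, aeval_X, ← mul_assoc, ← map_mul,
      inv_mul_cancel₀ h0, map_one, one_mul]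

/-- The zeros of the index form on the projective line are the roots of the minimal polynomial,
so that `p + 1 - r` of its points, where `r` is the number of roots, give rise to generators. -/
theorem natCard_generators_of_natDegree_eq_three {a : R}
    (hd : (minpoly (ZMod p) a).natDegree = 3) :
    Nat.card {b : R // vertexOf b = vertexOf a} =
      p * ((p - 1) * (p - (minpoly (ZMod p) a).roots.toFinset.card + 1)) := by
  obtain ⟨s, t, u, hm⟩ := exists_eq_cubic (minpoly.monic (isIntegral_of_finite_zmod (p := p) a)) hd
  set Z := {w : ZMod p // w ∉ (minpoly (ZMod p) a).roots.toFinset}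
  have hroot (w : ZMod p) : w ∉ (minpoly (ZMod p) a).roots.toFinset ↔
      w ^ 3 - s * w ^ 2 - t * w - u ≠ 0 := by
    rw [Multiset.mem_toFinset, mem_roots (minpoly_ne_zero_zmod a), IsRoot.def, hm]
    simp
  -- a triple with nonzero index form is `(x, y, 0)` with `y ≠ 0`, or `(x, z (w - s), z)` with
  -- `z ≠ 0` and `w` not a root
  let Y : ZMod p → Option Z → ZMod p := fun k o => o.elim k fun w => k * (w.1 - s)
  let W : ZMod p → Option Z → ZMod p := fun k o => o.elim 0 fun _ => k
  have hYW (k : (ZMod p)ˣ) (o : Option Z) : indexForm s t u (Y k o) (W k o) ≠ 0 := by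
    rcases o with _ | ⟨w, hw⟩
    · simp [Y, W, indexForm]
    · have hw' := (hroot w).1 hw
      have : indexForm s t u (Y k (some ⟨w, hw⟩)) (W k (some ⟨w, hw⟩)) =
          k ^ 3 * (w ^ 3 - s * w ^ 2 - t * w - u) := by
        simp only [Y, W, indexForm, Option.elim]
        ring
      rw [this]
      exact mul_ne_zero (pow_ne_zero _ k.ne_zero) hw'
  let f : ZMod p × (ZMod p)ˣ × Option Z → {b : R // vertexOf b = vertexOf a} := fun v =>
    ⟨aeval a (C v.1 + C (Y v.2.1 v.2.2) * X + C (W v.2.1 v.2.2) * X ^ 2), vertexOf_eq_iff.2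
      ⟨aeval_mem_singleGen _ _, (mem_singleGen_quadratic_iff hm _ _ _).2 (hYW _ _)⟩⟩
  have hf : Function.Bijective f := by
    constructor
    · rintro ⟨x, k, o⟩ ⟨x', k', o'⟩ h
      obtain ⟨h1, h2, h3⟩ := aeval_quadratic_injective hd (congrArg Subtype.val h)
      rcases o with _ | ⟨w, hw⟩ <;> rcases o' with _ | ⟨w', hw'⟩ <;>
        simp only [Y, W, Option.elim] at h1 h2 h3
      · simp [h1, Units.ext h2]
      · exact absurd h3.symm k'.ne_zero
      · exact absurd h3 k.ne_zero
      · obtain rfl := Units.ext h3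
        have := mul_left_cancel₀ k.ne_zero h2
        simp only [sub_left_inj] at this
        subst this
        simp [h1]
    · rintro ⟨b, hb⟩
      obtain ⟨hb1, hb2⟩ := vertexOf_eq_iff.1 hb
      obtain ⟨x, y, z, rfl⟩ := exists_aeval_quadratic_of_mem hd hb1
      have h0 := (mem_singleGen_quadratic_iff hm _ _ _).1 hb2
      by_cases hz : z = 0
      · subst hz
        have hy : y ≠ 0 := by
          rintro rfl
          simp [indexForm] at h0
        exact ⟨(x, Units.mk0 y hy, none), rfl⟩
      · have hw : y / z + s ∉ (minpoly (ZMod p) a).roots.toFinset := by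
          rw [hroot]
          intro hw
          apply h0
          have : y + s * z = z * (y / z + s) := by field_simp
          rw [indexForm, this, ← mul_zero (z ^ 3), ← hw]
          ring
        refine ⟨(x, Units.mk0 z hz, some ⟨_, hw⟩), Subtype.ext ?_⟩
        have hy : z * (y / z + s - s) = y := by field_simp; ring
        simp only [f, Y, W, Option.elim, Units.val_mk0, hy]
  have hZ : Fintype.card Z = p - (minpoly (ZMod p) a).roots.toFinset.card := by
    rw [Fintype.card_subtype_compl, ZMod.card, Fintype.card_coe]
  rw [← Nat.card_eq_of_bijective f hf, Nat.card_eq_fintype_card, Fintype.card_prod,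
    Fintype.card_prod, Fintype.card_option, hZ, ZMod.card_units_eq_totient,
    Nat.totient_prime Fact.out, ZMod.card]

theorem natCard_generators_of_natDegree_eq_two {a : R}
    (hd : (minpoly (ZMod p) a).natDegree = 2) :
    Nat.card {b : R // vertexOf b = vertexOf a} = p * (p - 1) := by
  have hd' : (minpoly (ZMod p) a).degree = 2 := by
    rw [degree_eq_natDegree (minpoly_ne_zero_zmod a), hd]; rfl
  have hgen (x : ZMod p) (k : (ZMod p)ˣ) : a ∈ singleGen (aeval a (C x + C (k : ZMod p) * X)) := by
    refine (mem_singleGen_iff_aeval (p := p)).2 ⟨C (↑k⁻¹ : ZMod p) * (X - C x), ?_⟩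
    rw [← aeval_comp]
    simp only [mul_comp, sub_comp, C_comp, X_comp, add_sub_cancel_left]
    rw [← mul_assoc, ← C_mul, Units.inv_mul, C_1, one_mul, aeval_X]
  let f : ZMod p × (ZMod p)ˣ → {b : R // vertexOf b = vertexOf a} := fun v =>
    ⟨aeval a (C v.1 + C (v.2 : ZMod p) * X),
      vertexOf_eq_iff.2 ⟨aeval_mem_singleGen _ _, hgen _ _⟩⟩
  have hf : Function.Bijective f := by
    constructor
    · rintro ⟨x, k⟩ ⟨x', k'⟩ h
      have h' := congrArg Subtype.val h
      simp only [f] at h'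
      rw [← sub_eq_zero, ← map_sub] at h'
      have h0 := eq_zero_of_aeval_eq_zero_of_degree_lt (a := a) (by
        rw [hd']
        have : (C x + C (k : ZMod p) * X - (C x' + C (k' : ZMod p) * X)).degree ≤ 1 := by
          compute_degree
        exact this.trans_lt (by norm_num)) h'
      obtain ⟨h1, h2, -⟩ := quadratic_eq_zero (x := x - x') (y := (k : ZMod p) - k') (z := 0) (by
        rw [← h0]; simp only [map_sub, map_zero]; ring)
      rw [sub_eq_zero] at h1 h2
      rw [h1, Units.ext h2]
    · rintro ⟨b, hb⟩
      obtain ⟨q, rfl⟩ := (mem_singleGen_iff_aeval (p := p)).1 (vertexOf_eq_iff.1 hb).1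
      have hm := minpoly.monic (isIntegral_of_finite_zmod (p := p) a)
      have hlt : (q %ₘ minpoly (ZMod p) a).natDegree < 2 := by
        rw [← hd]
        exact natDegree_modByMonic_lt _ hm (fun h => by rw [h] at hd; simp at hd)
      have hq : aeval a q = aeval a (q %ₘ minpoly (ZMod p) a) :=
        (aeval_modByMonic_eq_self_of_root (minpoly.aeval _ a)).symm
      set r := q %ₘ minpoly (ZMod p) a
      have hr : r = C (r.coeff 0) + C (r.coeff 1) * X := by
        conv_lhs => rw [as_sum_range_C_mul_X_pow' r hlt]
        simp [Finset.sum_range_succ]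
      have hk : r.coeff 1 ≠ 0 := by
        intro hk
        -- otherwise the generator would be a scalar
        have h1 := natDegree_minpoly_eq_of_vertexOf_eq (p := p) hb
        rw [hd] at h1
        refine X_sub_C_ne_zero (r.coeff 0) (eq_zero_of_aeval_eq_zero_of_degree_lt
          (a := aeval a q) ?_ ?_)
        · rw [degree_X_sub_C, degree_eq_natDegree (minpoly_ne_zero_zmod _), h1]
          norm_num
        · rw [hq, hr, hk]
          simp
      refine ⟨(r.coeff 0, Units.mk0 _ hk), Subtype.ext ?_⟩
      simp only [f, Units.val_mk0, hq]
      rw [← hr]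
  rw [← Nat.card_eq_of_bijective f hf, Nat.card_eq_fintype_card, Fintype.card_prod,
    ZMod.card_units_eq_totient, Nat.totient_prime Fact.out, ZMod.card]

theorem natDegree_minpoly_eq_one_iff [Nontrivial R] {a : R} :
    (minpoly (ZMod p) a).natDegree = 1 ↔ ∃ c : ZMod p, a = algebraMap (ZMod p) R c := by
  constructor
  · intro h
    have hm := minpoly.monic (isIntegral_of_finite_zmod (p := p) a)
    refine ⟨-(minpoly (ZMod p) a).coeff 0, ?_⟩
    have h0 := minpoly.aeval (ZMod p) a
    rw [hm.eq_X_add_C h] at h0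
    rw [map_neg, ← add_eq_zero_iff_eq_neg]
    simpa using h0
  · rintro ⟨c, rfl⟩
    rw [minpoly.eq_X_sub_C_of_algebraMap_inj _ (algebraMap (ZMod p) R).injective,
      natDegree_X_sub_C]

theorem natCard_generators_of_natDegree_eq_one [Nontrivial R] {a : R}
    (hd : (minpoly (ZMod p) a).natDegree = 1) :
    Nat.card {b : R // vertexOf b = vertexOf a} = p := by
  obtain ⟨c, rfl⟩ := natDegree_minpoly_eq_one_iff.1 hd
  refine Eq.trans ?_ ((natCard_singleGen (p := p) (algebraMap (ZMod p) R c)).trans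
    (by rw [hd, pow_one]))
  refine Nat.card_congr (Equiv.subtypeEquivRight fun b => ?_)
  rw [vertexOf_eq_iff]
  exact and_iff_left (algebraMap_mem_singleGen c b)

end Generators

/-! ### The eight types -/

section Kinds

variable {p : ℕ} [Fact p.Prime]

/-- The invariants that tell the types apart: the degree of the minimal polynomial of a matrix of
the given type, the number of its
(distinct) roots, and whether it is squarefree. -/
def MatrixKind.invariants : MatrixKind → ℕ × ℕ × Prop
  | .A => (1, 1, True)
  | .B => (2, 2, True)
  | .C => (3, 3, True)
  | .D => (3, 1, False)
  | .E => (2, 1, False)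
  | .F => (3, 2, False)
  | .G => (3, 0, True)
  | .H => (3, 1, True)

theorem MatrixKind.invariants_injective : Function.Injective MatrixKind.invariants := by
  intro K L h
  cases K <;> cases L <;> simp_all [MatrixKind.invariants]

theorem isCoprime_X_sub_C {K : Type*} [Field K] {l m : K} (h : l ≠ m) :
    IsCoprime (X - C l) (X - C m) :=
  isCoprime_X_sub_C_of_isUnit_sub (sub_ne_zero.2 h).isUnit

theorem not_squarefree_X_sub_C_sq_mul {K : Type*} [Field K] (l : K) (f : K[X]) :
    ¬ Squarefree ((X - C l) ^ 2 * f) := fun h =>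
  not_isUnit_X_sub_C l (h _ ⟨f, by rw [sq]⟩)

theorem IsOfKind.invariants_eq {M : Matrix (Fin 3) (Fin 3) (ZMod p)} {K : MatrixKind}
    (h : IsOfKind M K) :
    ((minpoly (ZMod p) M).natDegree, (minpoly (ZMod p) M).roots.toFinset.card,
      Squarefree (minpoly (ZMod p) M)) = K.invariants := by
  have h3 : M.charpoly.natDegree = 3 := by simp
  have sq (l : ZMod p) : Squarefree (X - C l) := (irreducible_X_sub_C l).squarefree
  have ne (l : ZMod p) : X - C l ≠ 0 := X_sub_C_ne_zero l
  rcases K with _ | _ | _ | _ | _ | _ | _ | _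
  · obtain ⟨l, -, hm⟩ := h
    simp [MatrixKind.invariants, hm, sq]
  · obtain ⟨l, m, hlm, -, hm⟩ := h
    have hs : Squarefree ((X - C l) * (X - C m)) :=
      squarefree_mul_iff.2 ⟨(isCoprime_X_sub_C hlm).isRelPrime, sq l, sq m⟩
    simp [MatrixKind.invariants, hm, hs, roots_mul, ne, hlm, natDegree_mul]
  · obtain ⟨l, m, n, hlm, hln, hmn, hc, hm⟩ := h
    have hs : Squarefree ((X - C l) * (X - C m) * (X - C n)) :=
      squarefree_mul_iff.2 ⟨((isCoprime_X_sub_C hln).mul_left (isCoprime_X_sub_C hmn)).isRelPrime,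
        squarefree_mul_iff.2 ⟨(isCoprime_X_sub_C hlm).isRelPrime, sq l, sq m⟩, sq n⟩
    simp [MatrixKind.invariants, hm, hc, hs, roots_mul, ne, hlm, hln, hmn, natDegree_mul]
  · obtain ⟨l, hc, hm⟩ := h
    have hs := not_squarefree_X_sub_C_sq_mul l (X - C l)
    rw [← pow_succ] at hs
    simp [MatrixKind.invariants, hm, hc, hs]
  · obtain ⟨l, hc, hm⟩ := h
    have hs := not_squarefree_X_sub_C_sq_mul l 1
    rw [mul_one] at hs
    simp [MatrixKind.invariants, hm, hs]
  · obtain ⟨l, m, hlm, hc, hm⟩ := h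
    have hs := not_squarefree_X_sub_C_sq_mul l (X - C m)
    simp [MatrixKind.invariants, hm, hc, hs, roots_mul, ne, natDegree_mul, hlm]
  · obtain ⟨hi, hm⟩ := h
    have hr : M.charpoly.roots = 0 := by
      by_contra h0
      obtain ⟨l, hl⟩ := Multiset.exists_mem_of_ne_zero h0
      exact hi.not_isRoot_of_natDegree_ne_one (by simp) (isRoot_of_mem_roots hl)
    simp [MatrixKind.invariants, hm, hr, hi.squarefree]
  · obtain ⟨l, f, hi, hc, hm⟩ := h
    have h2 : f.natDegree = 2 := by
      rw [hc, natDegree_mul (ne l) hi.ne_zero, natDegree_X_sub_C] at h3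
      omega
    have hroot (x : ZMod p) : ¬ f.IsRoot x := hi.not_isRoot_of_natDegree_ne_one (by omega)
    have hr : f.roots = 0 := by
      by_contra h0
      obtain ⟨l, hl⟩ := Multiset.exists_mem_of_ne_zero h0
      exact hroot l (isRoot_of_mem_roots hl)
    have hs : Squarefree ((X - C l) * f) := by
      refine squarefree_mul_iff.2 ⟨IsCoprime.isRelPrime ?_, sq l, hi.squarefree⟩
      rw [(irreducible_X_sub_C l).coprime_iff_not_dvd, dvd_iff_isRoot]
      exact hroot l
    simp [MatrixKind.invariants, hm, hc, hr, hs, roots_mul, ne, natDegree_mul, hi.ne_zero, h2]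

theorem IsOfKind.unique {M : Matrix (Fin 3) (Fin 3) (ZMod p)} {K L : MatrixKind}
    (hK : IsOfKind M K) (hL : IsOfKind M L) : K = L :=
  MatrixKind.invariants_injective (hK.invariants_eq.symm.trans hL.invariants_eq)

theorem isRoot_minpoly_of_isRoot_charpoly {M : Matrix (Fin 3) (Fin 3) (ZMod p)} {l : ZMod p}
    (h : M.charpoly.IsRoot l) : (minpoly (ZMod p) M).IsRoot l := by
  rw [← Matrix.minpoly_toLin', ← Module.End.hasEigenvalue_iff_isRoot,
    Module.End.hasEigenvalue_iff_isRoot_charpoly,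
    ← LinearMap.charpoly_toMatrix _ (Pi.basisFun _ _), LinearMap.toMatrix_eq_toMatrix',
    LinearMap.toMatrix'_toLin']
  exact h

theorem eq_X_sub_C_mul_X_sub_C {K : Type*} [Field K] {f : K[X]} (hf : f.Monic)
    (hd : f.natDegree = 2) {l : K} (hl : f.IsRoot l) : ∃ m, f = (X - C l) * (X - C m) := by
  obtain ⟨g, rfl⟩ := dvd_iff_isRoot.2 hl
  have hg : g.Monic := (monic_X_sub_C l).of_mul_monic_left hf
  rw [(monic_X_sub_C l).natDegree_mul hg, natDegree_X_sub_C] at hd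
  refine ⟨-g.coeff 0, ?_⟩
  rw [hg.eq_X_add_C (by omega)]
  simp

theorem isOfKind_G_iff_irreducible {M : Matrix (Fin 3) (Fin 3) (ZMod p)} :
    IsOfKind M .G ↔ Irreducible M.charpoly := by
  refine ⟨fun h => h.1, fun h => ⟨h, ?_⟩⟩
  exact (minpoly.eq_of_irreducible_of_monic h M.aeval_self_charpoly M.charpoly_monic).symm

theorem exists_isRoot_charpoly {M : Matrix (Fin 3) (Fin 3) (ZMod p)} (h : ¬ IsOfKind M .G) :
    ∃ l, M.charpoly.IsRoot l := by
  by_contra hroot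
  refine h (isOfKind_G_iff_irreducible.2 ?_)
  exact irreducible_of_degree_le_three_of_not_isRoot (by simp) (fun x hx => hroot ⟨x, hx⟩)

theorem exists_isOfKind (M : Matrix (Fin 3) (Fin 3) (ZMod p)) : ∃ K, IsOfKind M K := by
  have h3 : M.charpoly.natDegree = 3 := by simp
  have hcm := M.charpoly_monic
  set m := minpoly (ZMod p) M with hm
  have hmm : m.Monic := minpoly.monic (isIntegral_of_finite_zmod M)
  have hdvd : m ∣ M.charpoly := M.minpoly_dvd_charpoly
  have hpos : 0 < m.natDegree := minpoly.natDegree_pos (isIntegral_of_finite_zmod M)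
  have hle : m.natDegree ≤ 3 := h3 ▸ natDegree_le_of_dvd hdvd hcm.ne_zero
  obtain ⟨g, hg⟩ := hdvd
  have hgm : g.Monic := hmm.of_mul_monic_left (hg ▸ hcm)
  have hgd : m.natDegree + g.natDegree = 3 := by rw [← hmm.natDegree_mul hgm, ← hg, h3]
  obtain h1 | h2 | h3 : m.natDegree = 1 ∨ m.natDegree = 2 ∨ m.natDegree = 3 := by omega
  · obtain ⟨c, hc⟩ := natDegree_minpoly_eq_one_iff.1 h1
    refine ⟨.A, c, ?_, ?_⟩
    · rw [hc, Matrix.algebraMap_eq_diagonal, Matrix.charpoly_diagonal]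
      simp
    · rw [hc, minpoly.eq_X_sub_C_of_algebraMap_inj _ (algebraMap (ZMod p) _).injective]
  · obtain ⟨l, rfl⟩ : ∃ l, g = X - C l :=
      ⟨-g.coeff 0, by simpa using hgm.eq_X_add_C (by omega)⟩
    obtain ⟨n, hn⟩ := eq_X_sub_C_mul_X_sub_C hmm h2
      (isRoot_minpoly_of_isRoot_charpoly (dvd_iff_isRoot.1 ⟨m, hg.trans (mul_comm _ _)⟩))
    rw [hn] at hg
    by_cases hln : l = n
    · subst hln
      exact ⟨.E, l, by rw [hg]; ring, by rw [← hm, hn]; ring⟩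
    · exact ⟨.B, n, l, Ne.symm hln, by rw [hg]; ring, by rw [← hm, hn]; ring⟩
  · have hmc : m = M.charpoly := by
      rw [hg, hgm.natDegree_eq_zero.1 (by omega), mul_one]
    by_cases hG : IsOfKind M .G
    · exact ⟨_, hG⟩
    · obtain ⟨l, hl⟩ := exists_isRoot_charpoly hG
      obtain ⟨f, hf⟩ := dvd_iff_isRoot.2 hl
      have hfm : f.Monic := (monic_X_sub_C l).of_mul_monic_left (hf ▸ hcm)
      have hfd : f.natDegree = 2 := by
        have := congrArg natDegree hf
        rw [(monic_X_sub_C l).natDegree_mul hfm, natDegree_X_sub_C] at this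
        omega
      by_cases hroot' : ∃ x, f.IsRoot x
      · obtain ⟨x, hx⟩ := hroot'
        obtain ⟨y, rfl⟩ := eq_X_sub_C_mul_X_sub_C hfm hfd hx
        by_cases hlx : l = x
        · subst hlx
          by_cases hly : l = y
          · subst hly
            exact ⟨.D, l, by rw [hf]; ring, hmc⟩
          · exact ⟨.F, l, y, hly, by rw [hf]; ring, hmc⟩
        · by_cases hly : l = y
          · subst hly
            exact ⟨.F, l, x, hlx, by rw [hf]; ring, hmc⟩
          · by_cases hxy : x = y
            · subst hxy
              exact ⟨.F, x, l, Ne.symm hlx, by rw [hf]; ring, hmc⟩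
            · exact ⟨.C, l, x, y, hlx, hly, hxy, by rw [hf]; ring, hmc⟩
      · refine ⟨.H, l, f, ?_, hf, hmc⟩
        exact irreducible_of_degree_le_three_of_not_isRoot (by simp [hfd])
          (fun x hx => hroot' ⟨x, hx⟩)

theorem card_roots_toFinset_le (f : (ZMod p)[X]) : f.roots.toFinset.card ≤ p :=
  (Finset.card_le_univ _).trans_eq (ZMod.card p)

theorem natCard_generators {M : Matrix (Fin 3) (Fin 3) (ZMod p)} {K : MatrixKind}
    (h : IsOfKind M K) : Nat.card {N // vertexOf N = vertexOf M} = genNumber p K := by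
  have hp := (Fact.out : p.Prime).two_le
  have hinv := h.invariants_eq
  cases K <;> simp only [MatrixKind.invariants, Prod.mk.injEq] at hinv <;>
    obtain ⟨hd, hr, -⟩ := hinv <;> simp only [genNumber]
  · exact natCard_generators_of_natDegree_eq_one hd
  · exact natCard_generators_of_natDegree_eq_two hd
  · have hp3 : 3 ≤ p := by
      rw [← hr]
      exact card_roots_toFinset_le _
    rw [natCard_generators_of_natDegree_eq_three hd, hr, show p - 3 + 1 = p - 2 by omega]
    ring
  · rw [natCard_generators_of_natDegree_eq_three hd, hr, show p - 1 + 1 = p by omega]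
    ring
  · exact natCard_generators_of_natDegree_eq_two hd
  · rw [natCard_generators_of_natDegree_eq_three hd, hr, show p - 2 + 1 = p - 1 by omega]
    ring
  · rw [natCard_generators_of_natDegree_eq_three hd, hr, Nat.sub_zero, ← mul_assoc, mul_comm,
      mul_comm p, ← mul_assoc, ← Nat.sq_sub_sq p 1, one_pow, Nat.sub_mul, one_mul, ← pow_succ]
  · rw [natCard_generators_of_natDegree_eq_three hd, hr, show p - 1 + 1 = p by omega]
    ring

/-- The degree of the minimal polynomial of `M`, its being squarefree, and, in degree three, the
number of its roots depend only on the ring generated by `M`. -/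
theorem IsOfKind.of_vertexOf_eq {M N : Matrix (Fin 3) (Fin 3) (ZMod p)} {K : MatrixKind}
    (h : IsOfKind M K) (hMN : vertexOf M = vertexOf N) : IsOfKind N K := by
  obtain ⟨L, hL⟩ := exists_isOfKind N
  suffices K = L by rwa [this]
  have hd := natDegree_minpoly_eq_of_vertexOf_eq (p := p) hMN
  have hs := squarefree_minpoly_iff_of_vertexOf_eq (p := p) hMN
  -- for matrices with a minimal polynomial of degree three, the number of roots can be read off
  -- from the number of generators
  have hr : (minpoly (ZMod p) N).natDegree = 3 →
      (minpoly (ZMod p) M).roots.toFinset.card = (minpoly (ZMod p) N).roots.toFinset.card := by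
    intro h3
    have hcount := natCard_generators_of_natDegree_eq_three (hd.trans h3)
    rw [hMN, natCard_generators_of_natDegree_eq_three h3] at hcount
    have hp := (Fact.out : p.Prime).two_le
    have h1 := Nat.eq_of_mul_eq_mul_left (by omega)
      (Nat.eq_of_mul_eq_mul_left (by omega) hcount)
    have := card_roots_toFinset_le (minpoly (ZMod p) M)
    have := card_roots_toFinset_le (minpoly (ZMod p) N)
    omega
  have h1 := h.invariants_eq
  have h2 := hL.invariants_eq
  cases K <;> cases L <;> simp_all [MatrixKind.invariants]

end Kinds

/-! ### Matrices with an eigenvalue -/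

section RankOne

variable {p : ℕ} [Fact p.Prime]

theorem mem_center_matrix_iff {M : Matrix (Fin 3) (Fin 3) (ZMod p)} :
    M ∈ Subring.center (Matrix (Fin 3) (Fin 3) (ZMod p)) ↔
      ∃ c : ZMod p, M = algebraMap (ZMod p) _ c := by
  rw [← SetLike.mem_coe, Subring.coe_center, Matrix.center_eq_range, Set.mem_range]
  exact exists_congr fun c => eq_comm

theorem exists_ne_zero_orthogonal_to_pair {K : Type*} [Field K] (v w : Fin 3 → K) :
    ∃ x ≠ 0, v ⬝ᵥ x = 0 ∧ w ⬝ᵥ x = 0 := by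
  obtain ⟨x, hx, h⟩ := Matrix.exists_mulVec_eq_zero_iff.2
    (Matrix.det_eq_zero_of_row_eq_zero (A := Matrix.of ![v, w, 0]) 2 fun _ => rfl)
  exact ⟨x, hx, congrFun h 0, congrFun h 1⟩

theorem vecMulVec_notMem_center {u v : Fin 3 → ZMod p} (hu : u ≠ 0) (hv : v ≠ 0) :
    Matrix.vecMulVec u v ∉ Subring.center (Matrix (Fin 3) (Fin 3) (ZMod p)) := by
  rw [mem_center_matrix_iff]
  rintro ⟨c, hc⟩
  obtain ⟨x, hx, hvx, -⟩ := exists_ne_zero_orthogonal_to_pair v 0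
  have h1 := congrArg (fun N => N.mulVec x) hc
  simp only [Matrix.vecMulVec_mulVec, hvx, Algebra.algebraMap_eq_smul_one, Matrix.smul_mulVec,
    Matrix.one_mulVec] at h1
  have hc0 : c = 0 := by
    rcases smul_eq_zero.1 (h1.symm.trans (by simp)) with h | h
    · exact h
    · exact absurd h hx
  rw [hc0, map_zero, Matrix.vecMulVec_eq_zero] at hc
  exact hc.elim hu hv

theorem exists_eigenvector {M : Matrix (Fin 3) (Fin 3) (ZMod p)} {l : ZMod p}
    (h : M.charpoly.IsRoot l) : ∃ u ≠ 0, M.mulVec u = l • u := by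
  rw [← Matrix.mem_spectrum_iff_isRoot_charpoly, ← Matrix.spectrum_toLin',
    ← Module.End.hasEigenvalue_iff_mem_spectrum] at h
  obtain ⟨u, hu⟩ := h.exists_hasEigenvector
  exact ⟨u, hu.2, by simpa using hu.apply_eq_smul⟩

/-- If `u` is a right and `v` a left eigenvector for the same eigenvalue, then `M` commutes with
`u vᵀ`. -/
theorem exists_commute_vecMulVec {M : Matrix (Fin 3) (Fin 3) (ZMod p)} {l : ZMod p}
    (h : M.charpoly.IsRoot l) : ∃ u ≠ 0, ∃ v ≠ 0, Commute M (Matrix.vecMulVec u v) := by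
  obtain ⟨u, hu, hMu⟩ := exists_eigenvector h
  obtain ⟨v, hv, hMv⟩ := exists_eigenvector (M := M.transpose) (l := l)
    (by rwa [Matrix.charpoly_transpose])
  rw [Matrix.mulVec_transpose] at hMv
  refine ⟨u, hu, v, hv, ?_⟩
  rw [Commute, SemiconjBy, Matrix.mul_vecMulVec, Matrix.vecMulVec_mul, hMu, hMv,
    Matrix.smul_vecMulVec, Matrix.vecMulVec_smul]

theorem commutingGraph_reachable_of_commute {R : Type*} [Ring R]
    {a b : {a : R // a ∉ Subring.center R}} (h : Commute a.1 b.1) :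
    (commutingGraph R).Reachable a b := by
  by_cases hab : a = b
  · exact hab ▸ SimpleGraph.Reachable.refl _
  · exact SimpleGraph.Adj.reachable ⟨hab, h⟩

/-- Any two matrices `u vᵀ` and `u' v'ᵀ` commute with `x yᵀ` if `x` is orthogonal to `v` and `v'`
and `y` is orthogonal to `u` and `u'`; such `x` and `y` exist in dimension three. -/
theorem commutingGraph_reachable_of_not_G
    {M N : {M : Matrix (Fin 3) (Fin 3) (ZMod p) // M ∉ Subring.center _}}
    (hM : ¬ IsOfKind M.1 .G) (hN : ¬ IsOfKind N.1 .G) :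
    (commutingGraph (Matrix (Fin 3) (Fin 3) (ZMod p))).Reachable M N := by
  obtain ⟨l, hl⟩ := exists_isRoot_charpoly hM
  obtain ⟨l', hl'⟩ := exists_isRoot_charpoly hN
  obtain ⟨u, hu, v, hv, huv⟩ := exists_commute_vecMulVec hl
  obtain ⟨u', hu', v', hv', huv'⟩ := exists_commute_vecMulVec hl'
  obtain ⟨x, hx, hvx, hvx'⟩ := exists_ne_zero_orthogonal_to_pair v v'
  obtain ⟨y, hy, huy, huy'⟩ := exists_ne_zero_orthogonal_to_pair u u'
  rw [dotProduct_comm] at huy huy'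
  have comm {u v : Fin 3 → ZMod p} (h1 : v ⬝ᵥ x = 0) (h2 : y ⬝ᵥ u = 0) :
      Commute (Matrix.vecMulVec u v) (Matrix.vecMulVec x y) := by
    rw [Commute, SemiconjBy, Matrix.vecMulVec_mul_vecMulVec, Matrix.vecMulVec_mul_vecMulVec,
      h1, h2]
    simp
  let P : {M : Matrix (Fin 3) (Fin 3) (ZMod p) // M ∉ Subring.center _} :=
    ⟨_, vecMulVec_notMem_center hu hv⟩
  let P' : {M : Matrix (Fin 3) (Fin 3) (ZMod p) // M ∉ Subring.center _} :=
    ⟨_, vecMulVec_notMem_center hu' hv'⟩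
  let Q : {M : Matrix (Fin 3) (Fin 3) (ZMod p) // M ∉ Subring.center _} :=
    ⟨_, vecMulVec_notMem_center hx hy⟩
  have h1 := commutingGraph_reachable_of_commute (a := M) (b := P) huv
  have h2 := commutingGraph_reachable_of_commute (a := P) (b := Q) (comm hvx huy)
  have h3 := commutingGraph_reachable_of_commute (a := P') (b := Q) (comm hvx' huy')
  have h4 := commutingGraph_reachable_of_commute (a := N) (b := P') huv'
  exact (h1.trans h2).trans (h3.symm.trans h4.symm)

end RankOne

/-! ### Matrices with an irreducible characteristic polynomial -/

section IrreducibleCharpoly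

variable {p : ℕ} [Fact p.Prime]

theorem commute_aeval_self {R : Type*} [Ring R] [Algebra (ZMod p) R] (a : R) (q : (ZMod p)[X]) :
    Commute (aeval a q) a := by
  simpa using (Commute.all q X).map (aeval a)

theorem aeval_quadratic_mulVec (M : Matrix (Fin 3) (Fin 3) (ZMod p)) (v : Fin 3 → ZMod p)
    (x y z : ZMod p) : (aeval M (C x + C y * X + C z * X ^ 2)).mulVec v =
      x • v + y • M.mulVec v + z • (M ^ 2).mulVec v := by
  simp [Matrix.add_mulVec, Algebra.algebraMap_eq_smul_one, Matrix.smul_mulVec]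

/-- A polynomial of degree at most two that annihilates `v` at `M` is zero, as otherwise it would be
coprime to the characteristic polynomial, which also annihilates `v`. -/
theorem linearIndependent_krylov {M : Matrix (Fin 3) (Fin 3) (ZMod p)}
    (hM : Irreducible M.charpoly) {v : Fin 3 → ZMod p} (hv : v ≠ 0) :
    LinearIndependent (ZMod p) ![v, M.mulVec v, (M ^ 2).mulVec v] := by
  rw [Fintype.linearIndependent_iff]
  intro g hg
  set q : (ZMod p)[X] := C (g 0) + C (g 1) * X + C (g 2) * X ^ 2 with hq
  have hqv : (aeval M q).mulVec v = 0 := by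
    rw [hq, aeval_quadratic_mulVec, ← hg]
    simp [Fin.sum_univ_three]
  have hq0 : q = 0 := by
    by_contra h0
    have hcop : IsCoprime M.charpoly q := by
      rw [hM.coprime_iff_not_dvd]
      intro hdvd
      have h1 := natDegree_le_of_dvd hdvd h0
      have h2 : q.natDegree ≤ 2 := by rw [hq]; compute_degree
      simp at h1
      omega
    obtain ⟨r, s, hrs⟩ := hcop
    have h1 := congrArg (fun f => (aeval M f).mulVec v) hrs
    simp only [map_add, map_mul, M.aeval_self_charpoly, mul_zero, zero_add, map_one,
      Matrix.one_mulVec, ← Matrix.mulVec_mulVec, hqv, Matrix.mulVec_zero] at h1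
    exact hv h1.symm
  obtain ⟨h0, h1, h2⟩ := quadratic_eq_zero hq0
  intro i
  fin_cases i
  exacts [h0, h1, h2]

theorem eq_of_mulVec_eq_on {M N : Matrix (Fin 3) (Fin 3) (ZMod p)} {w : Fin 3 → Fin 3 → ZMod p}
    (hw : LinearIndependent (ZMod p) w) (h : ∀ i, M.mulVec (w i) = N.mulVec (w i)) : M = N := by
  apply Matrix.toLin'.injective
  refine (basisOfLinearIndependentOfCardEqFinrank hw (by simp)).ext fun i => ?_
  simpa using h i

/-- A matrix that commutes with `M` is determined by its value at one nonzero vector `v`, since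
`v, M v, M² v` is a basis. -/
theorem mem_singleGen_of_commute {M N : Matrix (Fin 3) (Fin 3) (ZMod p)}
    (hM : Irreducible M.charpoly) (h : Commute M N) : N ∈ singleGen M := by
  obtain ⟨v, hv⟩ := exists_ne (0 : Fin 3 → ZMod p)
  have hli := linearIndependent_krylov hM hv
  set B := basisOfLinearIndependentOfCardEqFinrank hli (by simp)
  have hN := B.sum_repr (N.mulVec v)
  simp only [Fin.sum_univ_three, B, coe_basisOfLinearIndependentOfCardEqFinrank] at hN
  refine (mem_singleGen_iff_aeval (p := p)).2
    ⟨C (B.repr (N.mulVec v) 0) + C (B.repr (N.mulVec v) 1) * X +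
      C (B.repr (N.mulVec v) 2) * X ^ 2, ?_⟩
  set q : (ZMod p)[X] := C (B.repr (N.mulVec v) 0) + C (B.repr (N.mulVec v) 1) * X +
      C (B.repr (N.mulVec v) 2) * X ^ 2 with hq
  have hqv : (aeval M q).mulVec v = N.mulVec v := by
    rw [hq, aeval_quadratic_mulVec]
    exact hN
  have hcomm : Commute (aeval M q) M := commute_aeval_self M _
  have hpow (k : ℕ) : (aeval M q).mulVec ((M ^ k).mulVec v) = N.mulVec ((M ^ k).mulVec v) := by
    rw [Matrix.mulVec_mulVec, Matrix.mulVec_mulVec, (hcomm.pow_right k).eq,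
      ← (h.pow_left k).eq, ← Matrix.mulVec_mulVec, ← Matrix.mulVec_mulVec, hqv]
  refine eq_of_mulVec_eq_on hli fun i => ?_
  fin_cases i
  · simpa using hpow 0
  · simpa using hpow 1
  · simpa using hpow 2

/-- The noncentral elements of the centralizer of a matrix of type (G) all generate the same vertex:
the index form has no zeros, since the minimal polynomial has no roots. -/
theorem vertexOf_eq_of_commute {M N : Matrix (Fin 3) (Fin 3) (ZMod p)}
    (hM : IsOfKind M .G) (h : Commute M N) (hN : N ∉ Subring.center _) :
    vertexOf N = vertexOf M := by
  have hmem := mem_singleGen_of_commute hM.1 h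
  have hinv := hM.invariants_eq
  simp only [MatrixKind.invariants, Prod.mk.injEq] at hinv
  obtain ⟨hd, hr, -⟩ := hinv
  refine vertexOf_eq_iff.2 ⟨hmem, ?_⟩
  obtain ⟨s, t, u, hm⟩ := exists_eq_cubic (minpoly.monic (isIntegral_of_finite_zmod (p := p) M)) hd
  obtain ⟨x, y, z, rfl⟩ := exists_aeval_quadratic_of_mem hd hmem
  rw [mem_singleGen_quadratic_iff hm]
  intro h0
  have hz : z = 0 := by
    by_contra hz
    have hroot : (minpoly (ZMod p) M).IsRoot (y / z + s) := by
      have h1 : y + s * z = z * (y / z + s) := by field_simp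
      have h2 : z ^ 3 * ((y / z + s) ^ 3 - s * (y / z + s) ^ 2 - t * (y / z + s) - u) = 0 := by
        rw [← h0, indexForm, h1]
        ring
      rw [IsRoot.def, hm]
      simpa using (mul_eq_zero.1 h2).resolve_left (pow_ne_zero 3 hz)
    have := Multiset.mem_toFinset.2 ((mem_roots (minpoly_ne_zero_zmod M)).2 hroot)
    rw [Finset.card_eq_zero.1 hr] at this
    exact absurd this (Finset.notMem_empty _)
  subst hz
  have hy : y = 0 := by simpa [indexForm] using h0
  subst hy
  exact hN (mem_center_matrix_iff.2 ⟨x, by simp⟩)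

theorem charpoly_eq_iff_aeval_eq_zero {f : (ZMod p)[X]} (hf : Irreducible f) (hfm : f.Monic)
    (hfd : f.natDegree = 3) {M : Matrix (Fin 3) (Fin 3) (ZMod p)} :
    M.charpoly = f ↔ aeval M f = 0 := by
  refine ⟨fun h => h ▸ M.aeval_self_charpoly, fun h => ?_⟩
  refine eq_of_monic_of_dvd_of_natDegree_le hfm M.charpoly_monic ?_ (by simp [hfd])
  rw [minpoly.eq_of_irreducible_of_monic hf h hfm]
  exact M.minpoly_dvd_charpoly

/-- There are `p³ - 1` choices of a nonzero vector `v`, and a matrix with characteristic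
polynomial `f` corresponds to the basis `v, M v, M² v`, which is an arbitrary one starting
with `v`. -/
theorem natCard_charpoly_eq {f : (ZMod p)[X]} (hf : Irreducible f) (hfm : f.Monic)
    (hfd : f.natDegree = 3) :
    Nat.card {M : Matrix (Fin 3) (Fin 3) (ZMod p) // M.charpoly = f} =
      (p ^ 3 - p) * (p ^ 3 - p ^ 2) := by
  obtain ⟨s, t, u, hstu⟩ := exists_eq_cubic hfm hfd
  let F : {v : Fin 3 → ZMod p // v ≠ 0} × {M : Matrix (Fin 3) (Fin 3) (ZMod p) // M.charpoly = f} →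
      {w : Fin 3 → Fin 3 → ZMod p // LinearIndependent (ZMod p) w} := fun x =>
    ⟨![x.1.1, x.2.1.mulVec x.1.1, (x.2.1 ^ 2).mulVec x.1.1],
      linearIndependent_krylov (by rw [x.2.2]; exact hf) x.1.2⟩
  have hcube (M : Matrix (Fin 3) (Fin 3) (ZMod p)) :
      aeval M f = M ^ 3 - s • M ^ 2 - t • M - u • 1 := by
    rw [hstu]
    simp [Algebra.smul_def]
  have hF : Function.Bijective F := by
    constructor
    · rintro ⟨⟨v, hv⟩, ⟨M, hM⟩⟩ ⟨⟨v', hv'⟩, ⟨N, hN⟩⟩ h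
      have h' := congrArg Subtype.val h
      have e0 : v = v' := congrFun h' 0
      subst e0
      have e1 : M.mulVec v = N.mulVec v := congrFun h' 1
      have e2 : (M ^ 2).mulVec v = (N ^ 2).mulVec v := congrFun h' 2
      have hcube' {M : Matrix (Fin 3) (Fin 3) (ZMod p)} (hM : M.charpoly = f) :
          (M ^ 3).mulVec v = s • (M ^ 2).mulVec v + t • M.mulVec v + u • v := by
        have h0 := hcube M
        rw [← hM, M.aeval_self_charpoly, eq_comm, sub_sub, sub_sub, sub_eq_zero] at h0
        rw [h0]
        simp [Matrix.add_mulVec, Matrix.smul_mulVec, add_assoc]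
      have e3 : M = N := by
        refine eq_of_mulVec_eq_on (F ⟨⟨v, hv⟩, ⟨M, hM⟩⟩).2 fun i => ?_
        fin_cases i
        · exact e1
        · have : M.mulVec (M.mulVec v) = N.mulVec (M.mulVec v) := by
            rw [Matrix.mulVec_mulVec, ← sq, e1, e2, sq, Matrix.mulVec_mulVec]
          exact this
        · have : M.mulVec ((M ^ 2).mulVec v) = N.mulVec ((M ^ 2).mulVec v) := by
            rw [Matrix.mulVec_mulVec, ← pow_succ', hcube' hM, e1, e2, ← hcube' hN, pow_succ',
              Matrix.mulVec_mulVec]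
          exact this
      subst e3
      rfl
    · rintro ⟨w, hw⟩
      -- the companion matrix of `f` with respect to the basis `w`
      set B := basisOfLinearIndependentOfCardEqFinrank hw (by simp)
      set M := LinearMap.toMatrix' (B.constr (ZMod p) ![w 1, w 2, s • w 2 + t • w 1 + u • w 0])
      have hMw (i : Fin 3) : M.mulVec (w i) = ![w 1, w 2, s • w 2 + t • w 1 + u • w 0] i := by
        rw [← Matrix.toLin'_apply, Matrix.toLin'_toMatrix',
          ← B.constr_basis (ZMod p) ![w 1, w 2, s • w 2 + t • w 1 + u • w 0] i]
        simp [B]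
      have h0 : M.mulVec (w 0) = w 1 := hMw 0
      have h1 : M.mulVec (w 1) = w 2 := hMw 1
      have h2 : M.mulVec (w 2) = s • w 2 + t • w 1 + u • w 0 := hMw 2
      have hsq : (M ^ 2).mulVec (w 0) = w 2 := by rw [sq, ← Matrix.mulVec_mulVec, h0, h1]
      have hw0 : w 0 ≠ 0 := hw.ne_zero 0
      have hker : (aeval M f).mulVec (w 0) = 0 := by
        rw [hcube, pow_succ']
        simp only [Matrix.sub_mulVec, Matrix.smul_mulVec, ← Matrix.mulVec_mulVec, hsq, h0, h2,
          Matrix.one_mulVec]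
        abel
      have hcomm (k : ℕ) : Commute (aeval M f) (M ^ k) :=
        (commute_aeval_self M f).pow_right k
      have hkill (k : ℕ) : (aeval M f).mulVec ((M ^ k).mulVec (w 0)) = 0 := by
        rw [Matrix.mulVec_mulVec, (hcomm k).eq, ← Matrix.mulVec_mulVec, hker, Matrix.mulVec_zero]
      have hzero : aeval M f = 0 := by
        refine eq_of_mulVec_eq_on hw fun i => ?_
        rw [Matrix.zero_mulVec]
        fin_cases i
        · exact hker
        · simpa [h0] using hkill 1
        · simpa [hsq] using hkill 2
      have hchar : M.charpoly = f := (charpoly_eq_iff_aeval_eq_zero hf hfm hfd).2 hzero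
      refine ⟨⟨⟨w 0, hw0⟩, ⟨M, hchar⟩⟩, Subtype.ext (funext fun i => ?_)⟩
      fin_cases i
      exacts [rfl, h0, hsq]
  have hcard := Nat.card_eq_of_bijective F hF
  rw [Nat.card_prod, card_linearIndependent (by simp)] at hcard
  have hv : Nat.card {v : Fin 3 → ZMod p // v ≠ 0} = p ^ 3 - 1 := by
    rw [Nat.card_eq_fintype_card, Fintype.card_subtype_compl]
    simp
  simp only [hv, Fin.prod_univ_three, ZMod.card, Module.finrank_fin_fun] at hcard
  have hp : 0 < p ^ 3 - 1 :=
    Nat.sub_pos_of_lt (Nat.one_lt_pow (by norm_num) (Fact.out : p.Prime).one_lt)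
  refine Nat.eq_of_mul_eq_mul_left hp (hcard.trans ?_)
  simp [mul_assoc]

end IrreducibleCharpoly

/-! ### The type of a vertex -/

section VertexKind

variable {p : ℕ} [Fact p.Prime]

/-- The type of a vertex of `Λ¹(M₃(GF(p)))`: the type of an arbitrarily chosen generator. -/
noncomputable def vertexKind (v : CompressedVertex (Matrix (Fin 3) (Fin 3) (ZMod p))) :
    MatrixKind :=
  (exists_isOfKind (vertexOf_surjective v).choose).choose

theorem isOfKind_iff_vertexKind_eq (M : Matrix (Fin 3) (Fin 3) (ZMod p)) (K : MatrixKind) :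
    IsOfKind M K ↔ vertexKind (vertexOf M) = K := by
  have h1 := (vertexOf_surjective (vertexOf M)).choose_spec
  have h2 := (exists_isOfKind (vertexOf_surjective (vertexOf M)).choose).choose_spec.of_vertexOf_eq
    h1
  exact ⟨fun h => h2.unique h, fun h => h ▸ h2⟩

theorem mem_center_iff_vertexOf_eq {M : Matrix (Fin 3) (Fin 3) (ZMod p)} :
    M ∈ Subring.center (Matrix (Fin 3) (Fin 3) (ZMod p)) ↔ vertexOf M = scalarVertex p := by
  rw [mem_center_matrix_iff, scalarVertex, vertexOf_eq_vertexOf_one_iff (p := p)]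

theorem vertexKind_eq_A_iff (v : CompressedVertex (Matrix (Fin 3) (Fin 3) (ZMod p))) :
    vertexKind v = .A ↔ v = scalarVertex p := by
  obtain ⟨M, rfl⟩ := vertexOf_surjective v
  rw [← isOfKind_iff_vertexKind_eq, ← mem_center_iff_vertexOf_eq, mem_center_matrix_iff,
    ← natDegree_minpoly_eq_one_iff]
  constructor
  · intro h
    exact congrArg Prod.fst h.invariants_eq
  · intro h
    obtain ⟨K, hK⟩ := exists_isOfKind M
    have := hK.invariants_eq
    cases K <;> simp_all [MatrixKind.invariants]

theorem natCard_generators_vertex (v : CompressedVertex (Matrix (Fin 3) (Fin 3) (ZMod p))) :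
    Nat.card {M : Matrix (Fin 3) (Fin 3) (ZMod p) // vertexOf M = v} =
      genNumber p (vertexKind v) := by
  obtain ⟨M, rfl⟩ := vertexOf_surjective v
  exact natCard_generators ((isOfKind_iff_vertexKind_eq M _).2 rfl)

/-! ### The number of vertices of type (G) -/

theorem exists_monic_irreducible_cubic (p : ℕ) [Fact p.Prime] :
    ∃ f : (ZMod p)[X], f.Monic ∧ Irreducible f ∧ f.natDegree = 3 := by
  obtain ⟨α, hα⟩ := Field.exists_primitive_element (ZMod p) (GaloisField p 3)
  have hint : IsIntegral (ZMod p) α := Algebra.IsIntegral.isIntegral α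
  exact ⟨_, minpoly.monic hint, minpoly.irreducible hint,
    ((Field.primitive_element_iff_minpoly_natDegree_eq _ α).1 hα).trans
      (GaloisField.finrank p (by norm_num))⟩

/-- Inside the field of `p³` elements generated by a matrix of type (G), an irreducible cubic has
three roots. -/
theorem natCard_charpoly_eq_and_vertexOf_eq {f : (ZMod p)[X]} (hf : Irreducible f)
    (hfm : f.Monic) (hfd : f.natDegree = 3) {A : Matrix (Fin 3) (Fin 3) (ZMod p)}
    (hA : IsOfKind A .G) :
    Nat.card {M : Matrix (Fin 3) (Fin 3) (ZMod p) // M.charpoly = f ∧ vertexOf M = vertexOf A} =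
      3 := by
  have : Fact (Irreducible f) := ⟨hf⟩
  have : Fact (Irreducible A.charpoly) := ⟨hA.1⟩
  have := (AdjoinRoot.powerBasis hA.1.ne_zero).finite
  have : Finite (AdjoinRoot A.charpoly) := Module.finite_of_finite (ZMod p)
  have h1 : Module.finrank (ZMod p) (AdjoinRoot f) = 3 := by
    rw [(AdjoinRoot.powerBasis hf.ne_zero).finrank, AdjoinRoot.powerBasis_dim, hfd]
  have h2 : Module.finrank (ZMod p) (AdjoinRoot A.charpoly) = 3 := by
    rw [(AdjoinRoot.powerBasis hA.1.ne_zero).finrank, AdjoinRoot.powerBasis_dim]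
    simp
  have hcard : Nat.card (AdjoinRoot f →ₐ[ZMod p] AdjoinRoot A.charpoly) = 3 :=
    (FiniteField.natCard_algHom_of_finrank_dvd (by rw [h1, h2])).trans h1
  -- the embedding of the field `GF(p)[x]/(p_A)` into the matrix ring that maps `x` to `A`
  let θ : AdjoinRoot A.charpoly →ₐ[ZMod p] Matrix (Fin 3) (Fin 3) (ZMod p) :=
    Ideal.Quotient.liftₐ (Ideal.span {A.charpoly}) (aeval A) (fun q hq => by
      obtain ⟨r, rfl⟩ := Ideal.mem_span_singleton.1 hq
      rw [map_mul, A.aeval_self_charpoly, zero_mul])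
  have hθ (q : (ZMod p)[X]) : θ (AdjoinRoot.mk _ q) = aeval A q := rfl
  have hθinj : Function.Injective θ := θ.toRingHom.injective
  have hF (φ : AdjoinRoot f →ₐ[ZMod p] AdjoinRoot A.charpoly) :
      (θ (φ (AdjoinRoot.root f))).charpoly = f ∧
        vertexOf (θ (φ (AdjoinRoot.root f))) = vertexOf A := by
    have hc : (θ (φ (AdjoinRoot.root f))).charpoly = f := by
      rw [charpoly_eq_iff_aeval_eq_zero hf hfm hfd, aeval_algHom_apply, aeval_algHom_apply,
        AdjoinRoot.aeval_eq, AdjoinRoot.mk_self, map_zero, map_zero]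
    refine ⟨hc, vertexOf_eq_of_commute hA ?_ ?_⟩
    · have := (Commute.all (AdjoinRoot.mk A.charpoly X) (φ (AdjoinRoot.root f))).map θ
      rwa [hθ, aeval_X] at this
    · intro hmem
      have hG : IsOfKind (θ (φ (AdjoinRoot.root f))) .G :=
        isOfKind_G_iff_irreducible.2 (by rw [hc]; exact hf)
      have hA' := (vertexKind_eq_A_iff _).2 (mem_center_iff_vertexOf_eq.1 hmem)
      rw [← isOfKind_iff_vertexKind_eq] at hA'
      exact MatrixKind.noConfusion (hG.unique hA')
  refine (Nat.card_eq_of_bijective (fun φ => ⟨θ (φ (AdjoinRoot.root f)), hF φ⟩)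
    ⟨?_, ?_⟩).symm.trans hcard
  · intro φ ψ h
    exact AdjoinRoot.algHom_ext (hθinj (congrArg Subtype.val h))
  · rintro ⟨M, hM, hMA⟩
    obtain ⟨q, rfl⟩ := (mem_singleGen_iff_aeval (p := p)).1 (vertexOf_eq_iff.1 hMA).1
    have hq : aeval (AdjoinRoot.mk A.charpoly q) f = 0 := by
      apply hθinj
      rw [← aeval_algHom_apply, hθ, map_zero]
      exact (charpoly_eq_iff_aeval_eq_zero hf hfm hfd).1 hM
    refine ⟨AdjoinRoot.liftAlgHom f (Algebra.ofId _ _) _ hq, Subtype.ext ?_⟩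
    exact (congrArg θ (AdjoinRoot.liftAlgHom_root f (Algebra.ofId _ _) _ hq)).trans (hθ q)

/-- For a fixed irreducible cubic `f`, every vertex of type (G) has exactly three generators with
characteristic polynomial `f`. -/
theorem three_mul_ncard_vertexKind_eq_G (p : ℕ) [Fact p.Prime] :
    3 * {v : CompressedVertex (Matrix (Fin 3) (Fin 3) (ZMod p)) | vertexKind v = .G}.ncard =
      (p ^ 3 - p) * (p ^ 3 - p ^ 2) := by
  obtain ⟨f, hfm, hf, hfd⟩ := exists_monic_irreducible_cubic p
  have : Finite (CompressedVertex (Matrix (Fin 3) (Fin 3) (ZMod p))) :=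
    Finite.of_surjective vertexOf vertexOf_surjective
  have := Fintype.ofFinite
    {v : CompressedVertex (Matrix (Fin 3) (Fin 3) (ZMod p)) // vertexKind v = .G}
  rw [← natCard_charpoly_eq hf hfm hfd]
  let g : {M : Matrix (Fin 3) (Fin 3) (ZMod p) // M.charpoly = f} →
      {v : CompressedVertex (Matrix (Fin 3) (Fin 3) (ZMod p)) // vertexKind v = .G} := fun M =>
    ⟨vertexOf M.1, (isOfKind_iff_vertexKind_eq _ _).1
      (isOfKind_G_iff_irreducible.2 (by rw [M.2]; exact hf))⟩
  have hfib (v) : Nat.card {M // g M = v} = 3 := by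
    obtain ⟨v, hv⟩ := v
    obtain ⟨A, rfl⟩ := vertexOf_surjective v
    refine Eq.trans ?_
      (natCard_charpoly_eq_and_vertexOf_eq hf hfm hfd ((isOfKind_iff_vertexKind_eq _ _).2 hv))
    refine Nat.card_congr ((Equiv.subtypeEquivRight fun M => ?_).trans
      (Equiv.subtypeSubtypeEquivSubtypeInter (fun M => M.charpoly = f)
        fun M => vertexOf M = vertexOf A))
    exact Subtype.ext_iff
  rw [← Nat.card_congr (Equiv.sigmaFiberEquiv g), Nat.card_sigma]
  simp only [hfib, Finset.sum_const, smul_eq_mul, Finset.card_univ]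
  rw [mul_comm, ← Nat.card_coe_set_eq, ← Nat.card_eq_fintype_card]
  rfl

end VertexKind

/-! ### Blow-up and connected components -/

/-- The components of a graph on `V` in which `S` is contained in one component, while the other
components are the fibres of `k` outside `S`. -/
theorem SimpleGraph.exists_component_eq {V X : Type*} (G : SimpleGraph V) (S : Set V) (k : V → X)
    (hne : S.Nonempty) (hk : ∀ v w, k v = k w → v ∈ S → w ∈ S)
    (hadj : ∀ v w, G.Adj v w → v ∉ S → k w = k v)
    (hS : ∀ v w, v ∈ S → w ∈ S → G.Reachable v w)
    (hfib : ∀ v w, k v = k w → G.Reachable v w) :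
    ∃ c₀ : G.ConnectedComponent, c₀.supp = S ∧
      (∀ c : G.ConnectedComponent, c ≠ c₀ → ∃ v ∉ S, c.supp = {w | k w = k v}) ∧
      {c : G.ConnectedComponent | c ≠ c₀}.ncard = (k '' Sᶜ).ncard := by
  have hreach {v w : V} (hv : v ∉ S) (h : G.Reachable v w) : k w = k v := by
    rw [SimpleGraph.reachable_iff_reflTransGen] at h
    induction h with
    | refl => rfl
    | tail _ hab ih => exact (hadj _ _ hab fun ha => hv (hk _ _ ih ha)).trans ih
  have hSc {v w : V} (h : G.Reachable v w) (hv : v ∈ S) : w ∈ S := by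
    by_contra hw
    exact hw (hk _ _ (hreach hw h.symm) hv)
  obtain ⟨v₀, hv₀⟩ := hne
  have hmem (v : V) : G.connectedComponentMk v = G.connectedComponentMk v₀ ↔ v ∈ S := by
    rw [SimpleGraph.ConnectedComponent.eq]
    exact ⟨fun h => hSc h.symm hv₀, fun h => hS _ _ h hv₀⟩
  have hout (c : G.ConnectedComponent) : G.connectedComponentMk c.out = c := Quot.out_eq c
  refine ⟨G.connectedComponentMk v₀, Set.ext fun v => hmem v, ?_, ?_⟩
  · intro c hc
    induction c using SimpleGraph.ConnectedComponent.ind with | _ v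
    have hv : v ∉ S := fun h => hc ((hmem v).2 h)
    refine ⟨v, hv, Set.ext fun w => ?_⟩
    rw [SimpleGraph.ConnectedComponent.mem_supp_iff, SimpleGraph.ConnectedComponent.eq]
    exact ⟨fun h => hreach hv h.symm, fun h => hfib _ _ h⟩
  · refine Set.ncard_congr (fun c _ => k c.out) ?_ ?_ ?_
    · intro c hc
      refine ⟨c.out, fun h => hc ?_, rfl⟩
      rw [← hout c]
      exact (hmem _).2 h
    · intro c d _ _ h
      rw [← hout c, ← hout d, SimpleGraph.ConnectedComponent.eq]
      exact hfib _ _ h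
    · rintro _ ⟨v, hv, rfl⟩
      refine ⟨G.connectedComponentMk v, fun h => hv ((hmem v).1 h), ?_⟩
      exact hreach hv (SimpleGraph.ConnectedComponent.eq.1 (hout _)).symm

section Graphs

variable {p : ℕ} [Fact p.Prime]

theorem commute_of_vertexOf_eq {R : Type*} [Ring R] {a b : R} (h : vertexOf a = vertexOf b) :
    Commute a b :=
  commute_of_mem_singleGen (Commute.refl b) (vertexOf_eq_iff.1 h).1

/-- The vertex of the reduced compressed graph generated by a noncentral matrix. -/
noncomputable def reducedVertexOf
    (M : {M : Matrix (Fin 3) (Fin 3) (ZMod p) // M ∉ Subring.center _}) :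
    {v : CompressedVertex (Matrix (Fin 3) (Fin 3) (ZMod p)) // v ≠ scalarVertex p} :=
  ⟨vertexOf M.1, fun h => M.2 (mem_center_iff_vertexOf_eq.2 h)⟩

theorem reducedVertexOf_surjective :
    Function.Surjective (reducedVertexOf : {_M : Matrix (Fin 3) (Fin 3) (ZMod p) // _} → _) := by
  rintro ⟨v, hv⟩
  obtain ⟨M, rfl⟩ := vertexOf_surjective v
  exact ⟨⟨M, fun h => hv (mem_center_iff_vertexOf_eq.1 h)⟩, rfl⟩

theorem reducedCompressedGraph_adj_iff
    {M N : {M : Matrix (Fin 3) (Fin 3) (ZMod p) // M ∉ Subring.center _}} :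
    (reducedCompressedGraph p).Adj (reducedVertexOf M) (reducedVertexOf N) ↔
      reducedVertexOf M ≠ reducedVertexOf N ∧ M.1 * N.1 = N.1 * M.1 :=
  and_congr_right fun _ => unitalCompressedCommutingGraph_adj M.1 N.1

/-- Generators of the same vertex commute, so that the generators of a vertex form a clique whose
members have the same neighbours outside it. -/
theorem exists_iso_cliqueBlowUp :
    ∃ φ : commutingGraph (Matrix (Fin 3) (Fin 3) (ZMod p)) ≃g
        (reducedCompressedGraph p).cliqueBlowUp (fun v => genNumber p (vertexKind v.1)),
      ∀ M, (φ M).1.1 = vertexOf M.1 := by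
  have hcard (v : {v : CompressedVertex (Matrix (Fin 3) (Fin 3) (ZMod p)) // v ≠ scalarVertex p}) :
      Nat.card {M // reducedVertexOf M = v} = genNumber p (vertexKind v.1) := by
    rw [← natCard_generators_vertex]
    refine Nat.card_eq_of_bijective
      (fun M => ⟨M.1.1, congrArg Subtype.val M.2⟩) ⟨fun M N h => ?_, ?_⟩
    · exact Subtype.ext (Subtype.ext (Subtype.mk.inj h))
    · rintro ⟨M, hM⟩
      exact ⟨⟨⟨M, fun h => v.2 (hM.symm.trans (mem_center_iff_vertexOf_eq.1 h))⟩,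
        Subtype.ext hM⟩, rfl⟩
  let φ := (Equiv.sigmaFiberEquiv (reducedVertexOf (p := p))).symm.trans
    (Equiv.sigmaCongrRight fun v => Finite.equivFinOfCardEq (hcard v))
  refine ⟨⟨φ, ?_⟩, fun M => rfl⟩
  intro M N
  have hadj : ((reducedCompressedGraph p).cliqueBlowUp
      (fun v => genNumber p (vertexKind v.1))).Adj (φ M) (φ N) ↔
      (reducedVertexOf M = reducedVertexOf N ∧ φ M ≠ φ N) ∨
        (reducedCompressedGraph p).Adj (reducedVertexOf M) (reducedVertexOf N) := Iff.rfl
  rw [hadj, reducedCompressedGraph_adj_iff, φ.injective.ne_iff]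
  constructor
  · rintro (⟨h, hne⟩ | ⟨hne, h⟩)
    · exact ⟨hne, commute_of_vertexOf_eq (congrArg Subtype.val h)⟩
    · exact ⟨fun h' => hne (congrArg _ h'), h⟩
  · rintro ⟨hne, h⟩
    by_cases hv : reducedVertexOf M = reducedVertexOf N
    · exact Or.inl ⟨hv, hne⟩
    · exact Or.inr ⟨hv, h⟩

/-- A path in the commuting graph induces one in the reduced compressed graph, where steps between
generators of the same vertex are dropped. -/
theorem reducedCompressedGraph_reachable
    {M N : {M : Matrix (Fin 3) (Fin 3) (ZMod p) // M ∉ Subring.center _}}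
    (h : (commutingGraph (Matrix (Fin 3) (Fin 3) (ZMod p))).Reachable M N) :
    (reducedCompressedGraph p).Reachable (reducedVertexOf M) (reducedVertexOf N) := by
  rw [SimpleGraph.reachable_iff_reflTransGen] at h
  induction h with
  | refl => exact SimpleGraph.Reachable.refl _
  | @tail P Q _ hPQ ih =>
    by_cases hv : reducedVertexOf P = reducedVertexOf Q
    · exact hv ▸ ih
    · exact ih.trans (SimpleGraph.Adj.reachable (reducedCompressedGraph_adj_iff.2 ⟨hv, hPQ.2⟩))

/-- A matrix `v vᵀ` has the eigenvalue zero, since some nonzero vector is orthogonal to `v`. -/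
theorem exists_noncentral_not_G (p : ℕ) [Fact p.Prime] :
    ∃ M : {M : Matrix (Fin 3) (Fin 3) (ZMod p) // M ∉ Subring.center _},
      ¬ IsOfKind M.1 .G := by
  obtain ⟨v, hv⟩ := exists_ne (0 : Fin 3 → ZMod p)
  refine ⟨⟨_, vecMulVec_notMem_center hv hv⟩, fun h => ?_⟩
  obtain ⟨x, hx, hvx, -⟩ := exists_ne_zero_orthogonal_to_pair v v
  exact (linearIndependent_krylov h.1 hx).ne_zero 1 (by simp [Matrix.vecMulVec_mulVec, hvx])

end Graphs

theorem mainTheorem5 (p : ℕ) [Fact p.Prime] :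
    -- `τ v` is the type of the vertex `v`: the common type of all its generators
    ∃ τ : CompressedVertex (Matrix (Fin 3) (Fin 3) (ZMod p)) → MatrixKind,
      (∀ (M : Matrix (Fin 3) (Fin 3) (ZMod p)) (K : MatrixKind),
        IsOfKind M K ↔ τ (vertexOf M) = K) ∧
      -- the scalar vertex is the unique vertex of type (A)
      (∀ v, τ v = MatrixKind.A ↔ v = scalarVertex p) ∧
      -- the number of single generators of a vertex
      (∀ v, Nat.card {M : Matrix (Fin 3) (Fin 3) (ZMod p) // vertexOf M = v}
        = genNumber p (τ v)) ∧
      -- the blow-up of the reduced graph is the commuting graph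
      (∃ φ : commutingGraph (Matrix (Fin 3) (Fin 3) (ZMod p)) ≃g
          (reducedCompressedGraph p).cliqueBlowUp (fun v => genNumber p (τ v.1)),
        ∀ M, (φ M).1.1 = vertexOf M.1) ∧
      -- the components of the reduced graph
      (∃ d₀ : (reducedCompressedGraph p).ConnectedComponent,
        d₀.supp = {v | τ v.1 ≠ MatrixKind.G} ∧
        (∀ d : (reducedCompressedGraph p).ConnectedComponent, d ≠ d₀ →
          ∃ v, d.supp = {v} ∧ τ v.1 = MatrixKind.G) ∧
        3 * {d : (reducedCompressedGraph p).ConnectedComponent | d ≠ d₀}.ncard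
          = (p ^ 3 - p) * (p ^ 3 - p ^ 2)) ∧
      -- the components of the commuting graph
      (∃ c₀ : (commutingGraph (Matrix (Fin 3) (Fin 3) (ZMod p))).ConnectedComponent,
        c₀.supp = {M | IsOfKind M.1 .B ∨ IsOfKind M.1 .C ∨ IsOfKind M.1 .D ∨
          IsOfKind M.1 .E ∨ IsOfKind M.1 .F ∨ IsOfKind M.1 .H} ∧
        (∀ c : (commutingGraph (Matrix (Fin 3) (Fin 3) (ZMod p))).ConnectedComponent, c ≠ c₀ →
          (commutingGraph (Matrix (Fin 3) (Fin 3) (ZMod p))).IsClique c.supp ∧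
          c.supp.ncard = p ^ 3 - p ∧
          ∀ M ∈ c.supp, IsOfKind M.1 .G) ∧
        3 * {c : (commutingGraph (Matrix (Fin 3) (Fin 3) (ZMod p))).ConnectedComponent |
            c ≠ c₀}.ncard
          = (p ^ 3 - p) * (p ^ 3 - p ^ 2)) := by
  refine ⟨vertexKind, isOfKind_iff_vertexKind_eq, vertexKind_eq_A_iff, natCard_generators_vertex,
    exists_iso_cliqueBlowUp, ?_, ?_⟩
  · obtain ⟨M₀, hM₀⟩ := exists_noncentral_not_G p
    obtain ⟨d₀, h₀, h, hcard⟩ := (reducedCompressedGraph p).exists_component_eq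
      {v | vertexKind v.1 ≠ .G} Subtype.val
      ⟨reducedVertexOf M₀, fun h => hM₀ ((isOfKind_iff_vertexKind_eq _ _).2 h)⟩
      (fun v w hvw => by simp only [Set.mem_ofPred_eq, hvw, imp_self])
      (fun v w hvw hv => by
        obtain ⟨M, rfl⟩ := reducedVertexOf_surjective v
        obtain ⟨N, rfl⟩ := reducedVertexOf_surjective w
        exact vertexOf_eq_of_commute ((isOfKind_iff_vertexKind_eq _ _).2 (not_not.1 hv))
          (reducedCompressedGraph_adj_iff.1 hvw).2 N.2)
      (fun v w hv hw => by
        obtain ⟨M, rfl⟩ := reducedVertexOf_surjective v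
        obtain ⟨N, rfl⟩ := reducedVertexOf_surjective w
        exact reducedCompressedGraph_reachable (commutingGraph_reachable_of_not_G
          (fun h => hv ((isOfKind_iff_vertexKind_eq _ _).1 h))
          (fun h => hw ((isOfKind_iff_vertexKind_eq _ _).1 h))))
      (fun v w hvw => Subtype.ext hvw ▸ SimpleGraph.Reachable.refl _)
    refine ⟨d₀, h₀, fun d hd => ?_, ?_⟩
    · obtain ⟨v, hv, hdv⟩ := h d hd
      exact ⟨v, hdv.trans (Set.ext fun w => Subtype.ext_iff.symm), not_not.1 hv⟩
    · rw [hcard, ← three_mul_ncard_vertexKind_eq_G]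
      congr 2
      ext v
      constructor
      · rintro ⟨w, hw, rfl⟩
        exact not_not.1 hw
      · intro hv
        refine ⟨⟨v, fun hs => ?_⟩, not_not.2 hv, rfl⟩
        rw [← vertexKind_eq_A_iff, show vertexKind v = .G from hv] at hs
        exact MatrixKind.noConfusion hs
  · obtain ⟨M₀, hM₀⟩ := exists_noncentral_not_G p
    obtain ⟨c₀, h₀, h, hcard⟩ :=
      (commutingGraph (Matrix (Fin 3) (Fin 3) (ZMod p))).exists_component_eq
      {M | ¬ IsOfKind M.1 .G} (fun M => vertexOf M.1) ⟨M₀, hM₀⟩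
      (fun M N hMN hM hN => hM (hN.of_vertexOf_eq hMN.symm))
      (fun M N hMN hM => vertexOf_eq_of_commute (not_not.1 hM) hMN.2 N.2)
      (fun M N hM hN => commutingGraph_reachable_of_not_G hM hN)
      (fun M N hMN => commutingGraph_reachable_of_commute (commute_of_vertexOf_eq hMN))
    refine ⟨c₀, ?_, fun c hc => ?_, ?_⟩
    · rw [h₀]
      ext M
      have hA : vertexKind (vertexOf M.1) ≠ .A := fun h =>
        M.2 (mem_center_iff_vertexOf_eq.2 ((vertexKind_eq_A_iff _).1 h))
      simp only [Set.mem_ofPred_eq, isOfKind_iff_vertexKind_eq]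
      cases hK : vertexKind (vertexOf M.1) <;> simp_all
    · obtain ⟨M, hM, hcM⟩ := h c hc
      have hM : IsOfKind M.1 .G := not_not.1 hM
      rw [hcM]
      refine ⟨fun N hN P hP hNP => ⟨hNP, commute_of_vertexOf_eq (Eq.trans hN (Eq.symm hP))⟩, ?_,
        fun N hN => hM.of_vertexOf_eq (Eq.symm hN)⟩
      rw [← Nat.card_coe_set_eq]
      refine Eq.trans ?_ (natCard_generators hM)
      refine Nat.card_eq_of_bijective (fun N => ⟨N.1.1, N.2⟩) ⟨fun N P h => ?_, ?_⟩
      · exact Subtype.ext (Subtype.ext (Subtype.mk.inj h))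
      · rintro ⟨N, hN⟩
        exact ⟨⟨⟨N, fun h => M.2 (mem_center_iff_vertexOf_eq.2
          (hN.symm.trans (mem_center_iff_vertexOf_eq.1 h)))⟩, hN⟩, rfl⟩
    · rw [hcard, ← three_mul_ncard_vertexKind_eq_G]
      congr 2
      ext v
      constructor
      · rintro ⟨M, hM, rfl⟩
        exact (isOfKind_iff_vertexKind_eq _ _).1 (not_not.1 hM)
      · intro hv
        obtain ⟨M, rfl⟩ := vertexOf_surjective v
        refine ⟨⟨M, fun hs => ?_⟩, not_not.2 ((isOfKind_iff_vertexKind_eq _ _).2 hv), rfl⟩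
        rw [mem_center_iff_vertexOf_eq, ← vertexKind_eq_A_iff,
          show vertexKind (vertexOf M) = .G from hv] at hs
        exact MatrixKind.noConfusion hs
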